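/- **Setting.** For every $n\ge 1$ consider a Gaussian Cluster Model of size $n$: the index set $\{1,\dots,n\}$ is partitioned into clusters $\mathcal C_1,\dots,\mathcal C_K$ of sizes $n_1,\dots,n_K$, and the observations $x_1,\dots,x_n\in\mathbb R^d$ are independent with $x_i\sim\mathcal N(\mu_k,\Sigma_k)$ if $i\in\mathcal C_k$. All of $d,K$, the partition, the means, the covariances and $f,\ell$ below may depend on $n$; the observations for all $n$ live on one probability space, with no assumption on their joint law across different $n$. Let $f:[0,\infty)\to[0,1]$ be $\ell$-Lipschitz, $A=(f(\|x_i-x_j\|_2))_{i,j}$ and $\bar A=\mathbb E A$. Write $i\sim j$ if $i,j$ are in the same cluster, and assume $$p=\inf_{i\sim j}\bar A_{ij}>q=\sup_{i\nsim j}\bar A_{ij}$$ for every $n\ge1$ (with $q=0$ if there is only one cluster). Let $\bar Z_{ij}=1$ if $i\sim j$ and $\bar Z_{ij}=0$ otherwise, and let $\widehat Z$ be any maximizer of $\langle A,Z\rangle=\sum_{i,j}A_{ij}Z_{ij}$ over the symmetric positive semidefinite matrices $Z\in\mathbb R^{n\times n}$ with non-negative entries, unit diagonal and $\sum_{i,j}Z_{ij}=\sum_k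 n_k^2$. Put $\sigma^2=\frac1n\sum_k n_k\rho(\Sigma_k)$, with $\rho$ the largest eigenvalue, and $$t_0=\frac{8\sqrt{2\log 2}\,K_G\,\sigma\,\ell}{p-q}.$$ Here $K_G$ is the real Grothendieck constant: the least $K$ such that, for all $n$ and all $B\in\mathbb R^{n\times n}$, $|\langle B,XY^{T}\rangle|\le K\sup_{\|u\|_\infty\le1}\|Bu\|_1$ for all $X,Y\in\mathbb R^{n\times n}$ whose rows have Euclidean norm at most $1$. Let $\|\cdot\|_1$ be the sum of the absolute values of the entries, and let $$\pi_n=\frac{2}{n(n-1)}\sum_{i<j}\bigl|1_{\{\widehat Z_{ij}>1/2\}}-\bar Z_{ij}\bigr|$$ be the proportion of misclassified edges. **Claim.** (1) Almost surely $$\limsup_{n\to\infty}n^{-2}\|\widehat Z-\bar Z\|_1\le\limsup_{n\to\infty}t_0\qquad\text{and}\qquad\limsup_{n\to\infty}\pi_n\le\limsup_{n\to\infty}2t_0 ;$$ in particular the first bound is $t_0$ and the second $2t_0$ if $\sigma,\ell,p,q$ do not depend on $n$. (2) The bound is $O(\sigma)$ for small variances: let $d$, $K$, pairwise different means $\mu_1,\dots,\mu_K\in\mathbb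 R^d$ and an $\ell$-Lipschitz $f:[0,\infty)\to[0,1]$ with $f(h)<f(0)$ for all $h>0$ be fixed. Then there are $C$ and $\varepsilon>0$ such that every Gaussian Cluster Model of any size $n\ge1$ with these means and with $\rho(\Sigma_k)\le\varepsilon$ for all $k$ satisfies $p>q$ and $t_0\le C\sigma$. -/

import Mathlib

open MeasureTheory ProbabilityTheory Filter
open scoped NNReal

noncomputable section

namespace GaussClust

/-! ### Matrices and the Grothendieck constant -/

/-- The scalar product `⟨A, B⟩ = ∑ A i j * B i j`. -/
def dot {n : ℕ} (A B : Matrix (Fin n) (Fin n) ℝ) : ℝ := ∑ i, ∑ j, A i j * B i j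

/-- The entrywise norm `‖A‖₁ = ∑ |A i j|`. -/
def norm1 {n : ℕ} (A : Matrix (Fin n) (Fin n) ℝ) : ℝ := ∑ i, ∑ j, |A i j|

/-- The norm of `B` as an operator from `ℓ^∞` to `ℓ^1`: the supremum of `‖B u‖₁` over all vectors
`u` with `‖u‖_∞ ≤ 1`. -/
def normInftyOne {n : ℕ} (B : Matrix (Fin n) (Fin n) ℝ) : ℝ :=
  sSup {r : ℝ | ∃ u : Fin n → ℝ, (∀ j, |u j| ≤ 1) ∧ r = ∑ i, |∑ j, B i j * u j|}

/-- The set of matrices `X * Yᵀ`, where all rows of the square matrices `X` and `Y` lie in the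
Euclidean unit ball. -/
def grothendieckSet (n : ℕ) : Set (Matrix (Fin n) (Fin n) ℝ) :=
  {Z | ∃ X Y : Matrix (Fin n) (Fin n) ℝ,
    (∀ i, ∑ j, X i j ^ 2 ≤ 1) ∧ (∀ i, ∑ j, Y i j ^ 2 ≤ 1) ∧ Z = X * Y.transpose}

/-- The (real) Grothendieck constant: the smallest `K` such that
`|⟨B, Z⟩| ≤ K * ‖B‖_{∞→1}` for all `n`, all `n × n` matrices `B` and all `Z` in
`grothendieckSet n`. -/
def grothendieckConst : ℝ :=
  sInf {K : ℝ | ∀ (n : ℕ) (B Z : Matrix (Fin n) (Fin n) ℝ), Z ∈ grothendieckSet n →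
    |dot B Z| ≤ K * normInftyOne B}

/-- The largest eigenvalue of a symmetric real matrix. -/
def largestEigenvalue {d : ℕ} (S : Matrix (Fin d) (Fin d) ℝ) : ℝ := sSup (spectrum ℝ S)

/-! ### The semidefinite program -/

/-- The feasible set: `Z` symmetric, `Z ⪰ 0`, `Z ≥ 0` entrywise, `diag Z = 1` and
`⟨Z, 1⟩ = lam`. -/
def feasible (n : ℕ) (lam : ℝ) : Set (Matrix (Fin n) (Fin n) ℝ) :=
  {Z | Z.PosSemidef ∧ (∀ i j, 0 ≤ Z i j) ∧ (∀ i, Z i i = 1) ∧ dot Z (fun _ _ => 1) = lam}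

/-- `Z` maximizes `⟨A, Z⟩` over the feasible set. -/
def IsSDPSolution {n : ℕ} (A : Matrix (Fin n) (Fin n) ℝ) (lam : ℝ)
    (Z : Matrix (Fin n) (Fin n) ℝ) : Prop :=
  Z ∈ feasible n lam ∧ ∀ W ∈ feasible n lam, dot A W ≤ dot A Z

/-- The affinity matrix of the points `x 1, …, x n`. -/
def affinity {n d : ℕ} (f : ℝ≥0 → ℝ) (x : Fin n → EuclideanSpace ℝ (Fin d)) :
    Matrix (Fin n) (Fin n) ℝ :=
  fun i j => f ‖x i - x j‖₊

/-! ### The Gaussian Cluster Model -/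

/-- The parameters of a Gaussian Cluster Model for `n` points of `ℝ^d` in `K` clusters: the cluster
to which each index belongs, the cluster means and the cluster covariance matrices. -/
structure Model (n d K : ℕ) where
  label : Fin n → Fin K
  mean : Fin K → EuclideanSpace ℝ (Fin d)
  cov : Fin K → Matrix (Fin d) (Fin d) ℝ
  cov_posSemidef : ∀ k, (cov k).PosSemidef

namespace Model

variable {n d K : ℕ} (M : Model n d K)

/-- The joint law of the observations `(x 1, …, x n)`: they are independent, and `x i` is Gaussian
with the mean and the covariance of the cluster of `i`. -/
def law : Measure (Fin n → EuclideanSpace ℝ (Fin d)) :=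
  Measure.pi fun i => multivariateGaussian (M.mean (M.label i)) (M.cov (M.label i))

/-- The size of the cluster `k`. -/
def size (k : Fin K) : ℕ := Fintype.card {i : Fin n // M.label i = k}

/-- `∑ n_k ^ 2`, the sum of the entries of the cluster matrix. -/
def lam0 : ℝ := ∑ k, (M.size k : ℝ) ^ 2

/-- The cluster matrix. -/
def clusterMatrix : Matrix (Fin n) (Fin n) ℝ :=
  fun i j => if M.label i = M.label j then 1 else 0

/-- The expected affinity matrix. -/
def meanAffinity (f : ℝ≥0 → ℝ) : Matrix (Fin n) (Fin n) ℝ :=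
  fun i j => ∫ x, affinity f x i j ∂M.law

/-- `p`, the infimum of the expected affinity over all pairs of indices in a common cluster. -/
def p (f : ℝ≥0 → ℝ) : ℝ :=
  sInf {a | ∃ i j, M.label i = M.label j ∧ a = M.meanAffinity f i j}

/-- `q`, the supremum of the expected affinity over all pairs of indices in distinct clusters
(`0`, the least possible affinity, if there is no such pair). -/
def q (f : ℝ≥0 → ℝ) : ℝ :=
  sSup {a | ∃ i j, M.label i ≠ M.label j ∧ a = M.meanAffinity f i j}

/-- `σ`, where `σ ^ 2 = (1 / n) ∑ n_k ρ(Σ_k)` and `ρ` is the largest eigenvalue. -/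
def sigma : ℝ :=
  Real.sqrt ((1 / (n : ℝ)) * ∑ k, (M.size k : ℝ) * largestEigenvalue (M.cov k))

/-- `t₀ = 8 √(2 log 2) K_G σ ℓ / (p - q)`. -/
def t0 (f : ℝ≥0 → ℝ) (l : ℝ≥0) : ℝ :=
  8 * Real.sqrt (2 * Real.log 2) * grothendieckConst * M.sigma * (l : ℝ) / (M.p f - M.q f)

/-- The proportion of the `n (n - 1) / 2` pairs `i < j` that are predicted wrongly when an edge is
put between `i` and `j` if and only if `Z i j > 1 / 2`. -/
def errorRate (Z : Matrix (Fin n) (Fin n) ℝ) : ℝ :=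
  2 / ((n : ℝ) * ((n : ℝ) - 1)) *
    ∑ i, ∑ j ∈ Finset.Ioi i, |(if 1 / 2 < Z i j then 1 else 0) - M.clusterMatrix i j|

end Model

end GaussClust

end

/-! The cluster matrix `Z̄` is itself feasible, so a maximizer satisfies `⟨Ā, Z̄ - Z⟩ ≤ ⟨A - Ā, Z -
Z̄⟩`. All entries of `Z - Z̄` lie in `[-1, 1]`, so the right side is at most `‖A - Ā‖₁`. Since `Z`
and `Z̄` have the same entry sum, `(p + q) / 2` may be subtracted from `Ā`, and the left side is at
least `(p - q) / 2 · ‖Z - Z̄‖₁`. This is `norm1_sub_clusterMatrix_le`; it remains to show that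
eventually `‖A - Ā‖₁ ≤ 4 n² σ ℓ`.

The norm of a Gaussian vector deviates from a constant by `O(√ρ)` in second and fourth moment,
whatever the dimension (`exists_norm_concentration`). A Lipschitz `f` inherits this, and summing
over the entries gives `E‖A - Ā‖₁ ≤ 3 n² σ ℓ`. For the fluctuation, the pairs `(i, j)` are sorted by
`i + j` mod `n`: each class is a sum of independent terms, and fourth moments give `P(‖A - Ā‖₁ > 4
n² σ ℓ) ≤ C / n²` (`exists_affinity_tail`). Borel–Cantelli finishes, with no condition on the joint
law across different `n`.

The resulting bound `8 σ ℓ / (p - q)` is below `t₀` because `K_G ≥ 1` and `√(2 log 2) ≥ 11/10`.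
Grothendieck's inequality is needed only to know that `K_G` is the infimum of a nonempty set; on the
empty set the real infimum would be `0`.

For small variances `Ā i j` is close to `f` at the distance of the two means, so `p - q` stays above
a positive constant (`exists_gap`) and `t₀` is linear in `σ`. -/

noncomputable section

namespace GaussClust

/-! ### Grothendieck's inequality -/

/-- The Rademacher sum `∑ ± x k` with the signs given by `ω`. -/
def rademacherSum {N : ℕ} (x : Fin N → ℝ) (ω : Fin N → Bool) : ℝ :=
  ∑ k, x k * (if ω k then 1 else -1)

lemma sum_signs_succ {N : ℕ} (g : (Fin (N + 1) → Bool) → ℝ) :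
    ∑ ω, g ω = ∑ ω : Fin N → Bool, (g (Fin.cons true ω) + g (Fin.cons false ω)) := by
  rw [← (Fin.consEquiv (fun _ => Bool)).sum_comp, Fintype.sum_prod_type]
  simp [Fin.consEquiv, Finset.sum_add_distrib]

lemma rademacherSum_cons_true {N : ℕ} (x : Fin (N + 1) → ℝ) (ω : Fin N → Bool) :
    rademacherSum x (Fin.cons true ω) = x 0 + rademacherSum (fun k => x k.succ) ω := by
  simp [rademacherSum, Fin.sum_univ_succ]

lemma rademacherSum_cons_false {N : ℕ} (x : Fin (N + 1) → ℝ) (ω : Fin N → Bool) :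
    rademacherSum x (Fin.cons false ω) = -x 0 + rademacherSum (fun k => x k.succ) ω := by
  simp [rademacherSum, Fin.sum_univ_succ]

/-- Independent signs are orthonormal: after division by `2 ^ N`, `x ↦ rademacherSum x` is an
isometry into `L²` of the cube. -/
lemma sum_rademacherSum_mul {N : ℕ} (x y : Fin N → ℝ) :
    ∑ ω, rademacherSum x ω * rademacherSum y ω = 2 ^ N * ∑ k, x k * y k := by
  induction N with
  | zero => simp [rademacherSum]
  | succ N ih =>
    have h := ih (fun k => x k.succ) (fun k => y k.succ)
    have : ∀ a b s t : ℝ, (a + s) * (b + t) + (-a + s) * (-b + t) = 2 * (a * b) + 2 * (s * t) := by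
      intros; ring
    simp only [sum_signs_succ, rademacherSum_cons_true, rademacherSum_cons_false, this]
    rw [Finset.sum_add_distrib, Finset.sum_const, ← Finset.mul_sum, h, Fin.sum_univ_succ]
    simp only [Finset.card_univ, Fintype.card_pi, Fintype.card_bool,
      Finset.prod_const, Fintype.card_fin, nsmul_eq_mul, Nat.cast_pow, Nat.cast_ofNat]
    ring

/-- Khintchine's inequality for the exponent 4, by splitting off one sign at a time. It controls the
tails cut off by `trunc`. -/
lemma sum_rademacherSum_pow_four_le {N : ℕ} (x : Fin N → ℝ) :
    ∑ ω, rademacherSum x ω ^ 4 ≤ 3 * 2 ^ N * (∑ k, x k ^ 2) ^ 2 := by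
  induction N with
  | zero => simp [rademacherSum]
  | succ N ih =>
    have h4 := ih (fun k => x k.succ)
    have h2 := sum_rademacherSum_mul (fun k => x k.succ) (fun k => x k.succ)
    have : ∀ a s : ℝ, (a + s) ^ 4 + (-a + s) ^ 4
        = 2 * a ^ 4 + 12 * a ^ 2 * (s * s) + 2 * s ^ 4 := by
      intros; ring
    simp only [sum_signs_succ, rademacherSum_cons_true, rademacherSum_cons_false, this]
    rw [Finset.sum_add_distrib, Finset.sum_add_distrib, Finset.sum_const, ← Finset.mul_sum,
      ← Finset.mul_sum, h2, Fin.sum_univ_succ]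
    simp only [← pow_two, Finset.card_univ, Fintype.card_pi, Fintype.card_bool,
      Finset.prod_const, Fintype.card_fin, nsmul_eq_mul, Nat.cast_pow, Nat.cast_ofNat] at h4 ⊢
    have hp : (0 : ℝ) ≤ 2 ^ N * x 0 ^ 4 := by positivity
    nlinarith [h4, hp, pow_succ (2 : ℝ) N]

/-- The bilinear expression `∑ B i j ⟨x i, y j⟩` in two families of vectors. -/
def vectorForm {n : ℕ} {ι : Type} [Fintype ι] (B : Matrix (Fin n) (Fin n) ℝ)
    (x y : Fin n → ι → ℝ) : ℝ := ∑ i, ∑ j, B i j * ∑ k, x i k * y j k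

/-- `c` bounds `vectorForm B` on all families in the unit balls of all `ℝ^N`. -/
def VectorFormBound {n : ℕ} (B : Matrix (Fin n) (Fin n) ℝ) (c : ℝ) : Prop :=
  ∀ (N : ℕ) (x y : Fin n → Fin N → ℝ), (∀ i, ∑ k, x i k ^ 2 ≤ 1) → (∀ i, ∑ k, y i k ^ 2 ≤ 1) →
    |vectorForm B x y| ≤ c

/-- Needed because `VectorFormBound.step` feeds in vectors indexed by the sign patterns `Fin N →
Bool`. -/
lemma VectorFormBound.fintype {n : ℕ} {B : Matrix (Fin n) (Fin n) ℝ} {c : ℝ}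
    (h : VectorFormBound B c) {ι : Type} [Fintype ι] (x y : Fin n → ι → ℝ)
    (hx : ∀ i, ∑ k, x i k ^ 2 ≤ 1) (hy : ∀ i, ∑ k, y i k ^ 2 ≤ 1) : |vectorForm B x y| ≤ c := by
  let e := Fintype.equivFin ι
  have := h _ (fun i k => x i (e.symm k)) (fun i k => y i (e.symm k))
    (fun i => by rw [e.symm.sum_comp (fun k => x i k ^ 2)]; exact hx i)
    (fun i => by rw [e.symm.sum_comp (fun k => y i k ^ 2)]; exact hy i)
  convert this using 2
  simp only [vectorForm]
  refine Finset.sum_congr rfl fun i _ => Finset.sum_congr rfl fun j _ => ?_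
  rw [e.symm.sum_comp (fun k => x i k * y j k)]

lemma vectorForm_swap {n : ℕ} {ι : Type} [Fintype ι] (B : Matrix (Fin n) (Fin n) ℝ)
    (x y : Fin n → ι → ℝ) : vectorForm B x y = ∑ k, ∑ i, ∑ j, B i j * (x i k * y j k) := by
  simp only [vectorForm, Finset.mul_sum]
  rw [Finset.sum_comm]
  simp_rw [Finset.sum_comm (s := Finset.univ (α := Fin n)) (t := Finset.univ (α := ι))]
  rw [Finset.sum_congr rfl fun k _ => Finset.sum_comm]

lemma vectorForm_smul_left {n : ℕ} {ι : Type} [Fintype ι] (B : Matrix (Fin n) (Fin n) ℝ)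
    (a : ℝ) (x y : Fin n → ι → ℝ) :
    vectorForm B (fun i k => a * x i k) y = a * vectorForm B x y := by
  simp only [vectorForm, Finset.mul_sum]
  refine Finset.sum_congr rfl fun i _ => Finset.sum_congr rfl fun j _ =>
    Finset.sum_congr rfl fun k _ => ?_
  ring

lemma vectorForm_smul_right {n : ℕ} {ι : Type} [Fintype ι] (B : Matrix (Fin n) (Fin n) ℝ)
    (a : ℝ) (x y : Fin n → ι → ℝ) :
    vectorForm B x (fun i k => a * y i k) = a * vectorForm B x y := by
  simp only [vectorForm, Finset.mul_sum]
  refine Finset.sum_congr rfl fun i _ => Finset.sum_congr rfl fun j _ =>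
    Finset.sum_congr rfl fun k _ => ?_
  ring

/-- Truncation of a real number at the level `6`. -/
def trunc (g : ℝ) : ℝ := if |g| ≤ 6 then g else 0

lemma abs_trunc_le (g : ℝ) : |trunc g| ≤ 6 := by
  unfold trunc; split_ifs with h <;> simp [h]

lemma trunc_sq_le (g : ℝ) : trunc g ^ 2 ≤ g ^ 2 := by
  unfold trunc; split_ifs with h
  · exact le_rfl
  · simpa using sq_nonneg g

lemma sub_trunc_sq_le (g : ℝ) : (g - trunc g) ^ 2 ≤ g ^ 4 / 36 := by
  unfold trunc; split_ifs with h
  · simpa using (by positivity : 0 ≤ g ^ 4 / 36)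
  · have h' : 36 ≤ g ^ 2 := by
      rw [← sq_abs]; nlinarith [not_le.1 h]
    have : g ^ 2 * 36 ≤ g ^ 2 * g ^ 2 := mul_le_mul_of_nonneg_left h' (sq_nonneg g)
    rw [sub_zero]; linarith [show g ^ 2 * g ^ 2 = g ^ 4 by ring]

/-- Replace the vectors by their Rademacher sums and truncate at 6. The truncated parts are bounded
pointwise, so the scalar bound `t` applies with factor `6²`. The remainders have norm at most `1/3`,
so the two mixed terms cost `c / 3` each by the old bound. -/
lemma VectorFormBound.step {n : ℕ} {B : Matrix (Fin n) (Fin n) ℝ} {c t : ℝ}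
    (h : VectorFormBound B c)
    (ht : ∀ a b : Fin n → ℝ, (∀ i, |a i| ≤ 1) → (∀ i, |b i| ≤ 1) →
      |∑ i, ∑ j, B i j * (a i * b j)| ≤ t) :
    VectorFormBound B (36 * t + 2 / 3 * c) := by
  intro N x y hx hy
  set w : ℝ := Real.sqrt (1 / 2 ^ N) with hw
  have hw2 : w ^ 2 = 1 / 2 ^ N := Real.sq_sqrt (by positivity)
  have hw2' : w ^ 2 * 2 ^ N = 1 := by rw [hw2]; field_simp
  have hnorm : ∀ z : Fin N → ℝ, ∑ k, z k ^ 2 ≤ 1 → ∑ ω, (w * rademacherSum z ω) ^ 2 ≤ 1 := by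
    intro z hz
    simp only [mul_pow, ← Finset.mul_sum]
    have := sum_rademacherSum_mul z z
    simp only [← pow_two] at this
    rw [this, ← mul_assoc, hw2', one_mul]; exact hz
  have hnormT : ∀ z : Fin N → ℝ, ∑ k, z k ^ 2 ≤ 1 →
      ∑ ω, (w * trunc (rademacherSum z ω)) ^ 2 ≤ 1 := by
    intro z hz
    refine le_trans (Finset.sum_le_sum fun ω _ => ?_) (hnorm z hz)
    rw [mul_pow, mul_pow]
    exact mul_le_mul_of_nonneg_left (trunc_sq_le _) (sq_nonneg _)
  -- The squared norm of the remainder is at most `3 / 36 = 1 / 12 < 1 / 9`.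
  have hnormR : ∀ z : Fin N → ℝ, ∑ k, z k ^ 2 ≤ 1 →
      ∑ ω, (3 * (w * (rademacherSum z ω - trunc (rademacherSum z ω)))) ^ 2 ≤ 1 := by
    intro z hz
    have h4 := sum_rademacherSum_pow_four_le z
    have hz2 : (∑ k, z k ^ 2) ^ 2 ≤ 1 :=
      pow_le_one₀ (Finset.sum_nonneg fun k _ => sq_nonneg _) hz
    calc ∑ ω, (3 * (w * (rademacherSum z ω - trunc (rademacherSum z ω)))) ^ 2
        ≤ ∑ ω, w ^ 2 / 4 * rademacherSum z ω ^ 4 := by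
          refine Finset.sum_le_sum fun ω _ => ?_
          rw [mul_pow, mul_pow]
          nlinarith [mul_le_mul_of_nonneg_left (sub_trunc_sq_le (rademacherSum z ω)) (sq_nonneg w)]
      _ = w ^ 2 / 4 * ∑ ω, rademacherSum z ω ^ 4 := by rw [Finset.mul_sum]
      _ ≤ w ^ 2 / 4 * (3 * 2 ^ N * (∑ k, z k ^ 2) ^ 2) := by gcongr
      _ = 3 / 4 * (w ^ 2 * 2 ^ N) * (∑ k, z k ^ 2) ^ 2 := by ring
      _ ≤ 1 := by rw [hw2']; linarith
  have hsplit : vectorForm B x y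
      = vectorForm B (fun i ω => w * trunc (rademacherSum (x i) ω))
          (fun j ω => w * trunc (rademacherSum (y j) ω))
        + 1 / 3 * vectorForm B
            (fun i ω => 3 * (w * (rademacherSum (x i) ω - trunc (rademacherSum (x i) ω))))
            (fun j ω => w * rademacherSum (y j) ω)
        + 1 / 3 * vectorForm B (fun i ω => w * trunc (rademacherSum (x i) ω))
            (fun j ω => 3 * (w * (rademacherSum (y j) ω - trunc (rademacherSum (y j) ω)))) := by
    rw [vectorForm_smul_left B 3, vectorForm_smul_right B 3]
    simp only [vectorForm, Finset.mul_sum (s := Finset.univ (α := Fin n)),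
      ← Finset.sum_add_distrib]
    refine Finset.sum_congr rfl fun i _ => Finset.sum_congr rfl fun j _ => ?_
    have h1 := sum_rademacherSum_mul (x i) (y j)
    have h2 : ∑ k, x i k * y j k
        = w ^ 2 * ∑ ω, rademacherSum (x i) ω * rademacherSum (y j) ω := by
      rw [h1, ← mul_assoc, hw2', one_mul]
    rw [h2]
    simp only [Finset.mul_sum, ← Finset.sum_add_distrib]
    refine Finset.sum_congr rfl fun ω _ => ?_
    ring
  have hT : |vectorForm B (fun i ω => w * trunc (rademacherSum (x i) ω))
      (fun j ω => w * trunc (rademacherSum (y j) ω))| ≤ 36 * t := by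
    rw [vectorForm_swap]
    have key : ∀ ω : Fin N → Bool, |∑ i, ∑ j, B i j * ((w * trunc (rademacherSum (x i) ω))
        * (w * trunc (rademacherSum (y j) ω)))| ≤ w ^ 2 * (36 * t) := by
      intro ω
      have := ht (fun i => trunc (rademacherSum (x i) ω) / 6)
        (fun i => trunc (rademacherSum (y i) ω) / 6)
        (fun i => by rw [abs_div, abs_of_pos (by norm_num : (0 : ℝ) < 6)]
                     linarith [abs_trunc_le (rademacherSum (x i) ω)])
        (fun i => by rw [abs_div, abs_of_pos (by norm_num : (0 : ℝ) < 6)]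
                     linarith [abs_trunc_le (rademacherSum (y i) ω)])
      have e : ∑ i, ∑ j, B i j * ((w * trunc (rademacherSum (x i) ω))
          * (w * trunc (rademacherSum (y j) ω))) = (w ^ 2 * 36) * ∑ i, ∑ j, B i j *
          (trunc (rademacherSum (x i) ω) / 6 * (trunc (rademacherSum (y j) ω) / 6)) := by
        simp only [Finset.mul_sum]
        refine Finset.sum_congr rfl fun i _ => Finset.sum_congr rfl fun j _ => ?_
        ring
      rw [e, abs_mul, abs_of_nonneg (by positivity), ← mul_assoc]
      gcongr
    refine (Finset.abs_sum_le_sum_abs _ _).trans ((Finset.sum_le_sum fun ω _ => key ω).trans ?_)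
    simp only [Finset.sum_const, Finset.card_univ, Fintype.card_pi, Fintype.card_bool,
      Finset.prod_const, Fintype.card_fin, nsmul_eq_mul, Nat.cast_pow, Nat.cast_ofNat]
    rw [← mul_assoc, mul_comm (2 ^ N), hw2', one_mul]
  have hR1 := h.fintype
    (fun i ω => 3 * (w * (rademacherSum (x i) ω - trunc (rademacherSum (x i) ω))))
    (fun j ω => w * rademacherSum (y j) ω) (fun i => hnormR _ (hx i)) (fun j => hnorm _ (hy j))
  have hR2 := h.fintype (fun i ω => w * trunc (rademacherSum (x i) ω))
    (fun j ω => 3 * (w * (rademacherSum (y j) ω - trunc (rademacherSum (y j) ω))))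
    (fun i => hnormT _ (hx i)) (fun j => hnormR _ (hy j))
  rw [hsplit]
  rw [abs_le] at *
  constructor <;> linarith [hT.1, hT.2, hR1.1, hR1.2, hR2.1, hR2.2]

lemma vectorFormBound_norm1 {n : ℕ} (B : Matrix (Fin n) (Fin n) ℝ) :
    VectorFormBound B (norm1 B) := by
  intro N x y hx hy
  refine (Finset.abs_sum_le_sum_abs _ _).trans (Finset.sum_le_sum fun i _ =>
    (Finset.abs_sum_le_sum_abs _ _).trans (Finset.sum_le_sum fun j _ => ?_))
  rw [abs_mul]
  refine mul_le_of_le_one_right (abs_nonneg _) ?_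
  rw [← sq_le_one_iff_abs_le_one]
  exact (Finset.sum_mul_sq_le_sq_mul_sq _ _ _).trans
    (mul_le_one₀ (hx i) (Finset.sum_nonneg fun k _ => sq_nonneg _) (hy j))

/-- `108 * t` is the fixed point of the contraction `c ↦ 36 * t + 2 / 3 * c`, iterated from the
trivial bound `norm1 B`. -/
lemma vectorFormBound_of_bilinear {n : ℕ} {B : Matrix (Fin n) (Fin n) ℝ} {t : ℝ}
    (ht : ∀ a b : Fin n → ℝ, (∀ i, |a i| ≤ 1) → (∀ i, |b i| ≤ 1) →
      |∑ i, ∑ j, B i j * (a i * b j)| ≤ t) : VectorFormBound B (108 * t) := by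
  have hk : ∀ k : ℕ, VectorFormBound B (108 * t + (2 / 3) ^ k * (norm1 B - 108 * t)) := by
    intro k
    induction k with
    | zero => simpa using vectorFormBound_norm1 B
    | succ k ih =>
      convert ih.step ht using 1
      ring
  intro N x y hx hy
  have hlim : Tendsto (fun k : ℕ => 108 * t + (2 / 3 : ℝ) ^ k * (norm1 B - 108 * t)) atTop
      (nhds (108 * t + 0 * (norm1 B - 108 * t))) :=
    ((tendsto_pow_atTop_nhds_zero_of_lt_one (by norm_num) (by norm_num)).mul_const _).const_add _
  rw [zero_mul, add_zero] at hlim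
  exact ge_of_tendsto' hlim fun k => hk k N x y hx hy

lemma abs_sum_mul_le_norm1_row {n : ℕ} (B : Matrix (Fin n) (Fin n) ℝ) {u : Fin n → ℝ}
    (hu : ∀ j, |u j| ≤ 1) : ∑ i, |∑ j, B i j * u j| ≤ norm1 B := by
  refine Finset.sum_le_sum fun i _ =>
    (Finset.abs_sum_le_sum_abs _ _).trans (Finset.sum_le_sum fun j _ => ?_)
  rw [abs_mul]
  exact mul_le_of_le_one_right (abs_nonneg _) (hu j)

lemma le_normInftyOne {n : ℕ} (B : Matrix (Fin n) (Fin n) ℝ) {u : Fin n → ℝ}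
    (hu : ∀ j, |u j| ≤ 1) : ∑ i, |∑ j, B i j * u j| ≤ normInftyOne B := by
  refine le_csSup ⟨norm1 B, ?_⟩ ⟨u, hu, rfl⟩
  rintro r ⟨v, hv, rfl⟩
  exact abs_sum_mul_le_norm1_row B hv

lemma abs_bilinear_le_normInftyOne {n : ℕ} (B : Matrix (Fin n) (Fin n) ℝ) (a b : Fin n → ℝ)
    (ha : ∀ i, |a i| ≤ 1) (hb : ∀ i, |b i| ≤ 1) :
    |∑ i, ∑ j, B i j * (a i * b j)| ≤ normInftyOne B := by
  refine le_trans ?_ (le_normInftyOne B hb)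
  refine (Finset.abs_sum_le_sum_abs _ _).trans (Finset.sum_le_sum fun i _ => ?_)
  have : ∑ j, B i j * (a i * b j) = a i * ∑ j, B i j * b j := by
    rw [Finset.mul_sum]; exact Finset.sum_congr rfl fun j _ => by ring
  rw [this, abs_mul]
  exact mul_le_of_le_one_left (abs_nonneg _) (ha i)

/-- **Grothendieck's inequality**, with a constant that is not optimal. -/
theorem grothendieck_inequality (n : ℕ) (B Z : Matrix (Fin n) (Fin n) ℝ)
    (hZ : Z ∈ grothendieckSet n) : |dot B Z| ≤ 108 * normInftyOne B := by
  obtain ⟨X, Y, hX, hY, rfl⟩ := hZ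
  have := vectorFormBound_of_bilinear (abs_bilinear_le_normInftyOne B) n X Y hX hY
  simpa [dot, vectorForm, Matrix.mul_apply] using this

/-- The lower bound is seen on `1 × 1` matrices; the admissible constant 108 makes `le_csInf`
applicable. -/
theorem one_le_grothendieckConst : 1 ≤ grothendieckConst := by
  refine le_csInf ⟨108, grothendieck_inequality⟩ fun K hK => ?_
  have h := hK 1 (Matrix.of fun _ _ => 1) (Matrix.of fun _ _ => 1)
    ⟨Matrix.of fun _ _ => 1, Matrix.of fun _ _ => 1, by simp, by simp, by
      ext i j; simp [Matrix.mul_apply]⟩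
  have h1 : normInftyOne (Matrix.of fun _ _ : Fin 1 => (1 : ℝ)) ≤ 1 := by
    refine csSup_le ⟨0, 0, by simp, by simp⟩ ?_
    rintro r ⟨u, hu, rfl⟩
    simpa using hu 0
  have h0 : 0 ≤ normInftyOne (Matrix.of fun _ _ : Fin 1 => (1 : ℝ)) := by
    have := le_normInftyOne (Matrix.of fun _ _ : Fin 1 => (1 : ℝ)) (u := 0) (by simp)
    simpa using this
  have h' : 1 ≤ K * normInftyOne (Matrix.of fun _ _ : Fin 1 => (1 : ℝ)) := by simpa [dot] using h
  by_contra hlt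
  rcases le_or_gt K 0 with hK0 | hK0 <;> nlinarith

/-! ### The semidefinite program -/

lemma dot_sub_left {n : ℕ} (A B C : Matrix (Fin n) (Fin n) ℝ) :
    dot (A - B) C = dot A C - dot B C := by
  simp [dot, sub_mul, Finset.sum_sub_distrib]

lemma dot_sub_right {n : ℕ} (A B C : Matrix (Fin n) (Fin n) ℝ) :
    dot A (B - C) = dot A B - dot A C := by
  simp [dot, mul_sub, Finset.sum_sub_distrib]

/-- The quadratic form at `e_i - e_j` is `2 - 2 * Z i j`. -/
lemma entry_le_one {n : ℕ} {Z : Matrix (Fin n) (Fin n) ℝ} (hZ : Z.PosSemidef)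
    (hd : ∀ i, Z i i = 1) (i j : Fin n) : Z i j ≤ 1 := by
  have h := hZ.dotProduct_mulVec_nonneg (Pi.single i 1 - Pi.single j 1)
  have hs : Z j i = Z i j := by simpa using hZ.isHermitian.apply i j
  simp [Matrix.mulVec_sub, sub_dotProduct, hd, hs] at h
  linarith

namespace Model

variable {n d K : ℕ} (M : Model n d K)

lemma clusterMatrix_posSemidef : M.clusterMatrix.PosSemidef := by
  have h : M.clusterMatrix = (Matrix.of fun (k : Fin K) (i : Fin n) =>
      if M.label i = k then (1 : ℝ) else 0).conjTranspose * (Matrix.of fun (k : Fin K) (i : Fin n) =>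
      if M.label i = k then (1 : ℝ) else 0) := by
    ext i j
    simp [clusterMatrix, Matrix.mul_apply, eq_comm]
  rw [h]
  exact Matrix.posSemidef_conjTranspose_mul_self _

lemma size_eq_sum (k : Fin K) : (M.size k : ℝ) = ∑ i, if M.label i = k then 1 else 0 := by
  simp [size, Fintype.card_subtype]

lemma sum_size_mul (g : Fin K → ℝ) : ∑ k, (M.size k : ℝ) * g k = ∑ i, g (M.label i) := by
  simp only [size_eq_sum, Finset.sum_mul]
  rw [Finset.sum_comm]
  simp

lemma clusterMatrix_mem_feasible : M.clusterMatrix ∈ feasible n M.lam0 := by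
  refine ⟨M.clusterMatrix_posSemidef, fun i j => ?_, fun i => by simp [clusterMatrix], ?_⟩
  · unfold clusterMatrix; split_ifs <;> norm_num
  · simp only [lam0, pow_two]
    rw [M.sum_size_mul (fun k => (M.size k : ℝ))]
    simp [dot, clusterMatrix, size_eq_sum, eq_comm]

/-- A maximizer of the semidefinite program is close to the cluster matrix if the affinity matrix
is close to a matrix that separates the clusters. -/
lemma norm1_sub_clusterMatrix_le {A Abar Z : Matrix (Fin n) (Fin n) ℝ} {p q : ℝ}
    (hp : ∀ i j, M.label i = M.label j → p ≤ Abar i j)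
    (hq : ∀ i j, M.label i ≠ M.label j → Abar i j ≤ q)
    (hZ : IsSDPSolution A M.lam0 Z) :
    (p - q) * norm1 (Z - M.clusterMatrix) ≤ 2 * norm1 (A - Abar) := by
  obtain ⟨⟨hpsd, hpos, hdiag, hsum⟩, hmax⟩ := hZ
  obtain ⟨-, -, -, hsum'⟩ := M.clusterMatrix_mem_feasible
  have hle := hmax _ M.clusterMatrix_mem_feasible
  have hentry : ∀ i j, |(Z - M.clusterMatrix) i j| ≤ 1 := by
    intro i j
    have h0 := hpos i j
    have h1 := entry_le_one hpsd hdiag i j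
    rw [Matrix.sub_apply, abs_le]
    unfold clusterMatrix
    split_ifs <;> constructor <;> linarith
  have hdot : dot (A - Abar) (Z - M.clusterMatrix) ≤ norm1 (A - Abar) := by
    refine Finset.sum_le_sum fun i _ => Finset.sum_le_sum fun j _ => ?_
    refine (le_abs_self _).trans ?_
    rw [abs_mul]
    exact mul_le_of_le_one_right (abs_nonneg _) (hentry i j)
  -- Entrywise, `Abar - (p + q) / 2` has the sign of `clusterMatrix - Z` and modulus at least `(p -
  -- q) / 2`. The constant part vanishes below by equality of the entry sums.
  have hsep : (p - q) / 2 * norm1 (Z - M.clusterMatrix)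
      + (p + q) / 2 * dot (M.clusterMatrix - Z) (fun _ _ => 1)
      ≤ dot Abar (M.clusterMatrix - Z) := by
    simp only [norm1, dot, Finset.mul_sum, ← Finset.sum_add_distrib]
    refine Finset.sum_le_sum fun i _ => Finset.sum_le_sum fun j _ => ?_
    have h0 := hpos i j
    have h1 := entry_le_one hpsd hdiag i j
    simp only [Matrix.sub_apply]
    by_cases h : M.label i = M.label j
    · have := hp i j h
      simp only [clusterMatrix, if_pos h]
      rw [abs_of_nonpos (by linarith)]
      nlinarith
    · have := hq i j h
      simp only [clusterMatrix, if_neg h]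
      rw [abs_of_nonneg (by linarith)]
      nlinarith
  have hzero : dot (M.clusterMatrix - Z) (fun _ _ => 1) = 0 :=
    (dot_sub_left _ _ _).trans (by rw [hsum, hsum', sub_self])
  rw [hzero, mul_zero, add_zero] at hsep
  rw [dot_sub_left, dot_sub_right, dot_sub_right] at hdot
  rw [dot_sub_right] at hsep
  linarith

/-- A wrongly predicted edge means an entry error of at least `1/2`. This factor 2 is offset by
symmetry, as the pairs `i < j` carry at most half of the norm. -/
lemma errorRate_le {Z : Matrix (Fin n) (Fin n) ℝ} (hZ : Z.PosSemidef) (hn : 2 ≤ n) :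
    M.errorRate Z ≤ 2 / ((n : ℝ) * ((n : ℝ) - 1)) * norm1 (Z - M.clusterMatrix) := by
  have hn' : (2 : ℝ) ≤ n := by exact_mod_cast hn
  unfold errorRate
  refine mul_le_mul_of_nonneg_left ?_ (div_nonneg (by norm_num) (by nlinarith))
  have hswap : ∀ i j, |(Z - M.clusterMatrix) i j| = |(Z - M.clusterMatrix) j i| := by
    intro i j
    have h1 : Z j i = Z i j := by simpa using hZ.isHermitian.apply i j
    simp only [Matrix.sub_apply, h1, clusterMatrix, eq_comm]
  have hsum : norm1 (Z - M.clusterMatrix)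
      = ∑ i, |(Z - M.clusterMatrix) i i|
        + 2 * ∑ i, ∑ j ∈ Finset.Ioi i, |(Z - M.clusterMatrix) i j| := by
    have h2 : ∑ i : Fin n, ∑ j ∈ Finset.Iio i, |(Z - M.clusterMatrix) i j|
        = ∑ i, ∑ j ∈ Finset.Ioi i, |(Z - M.clusterMatrix) i j| := by
      rw [Finset.sum_comm' (t' := Finset.univ) (s' := fun j => Finset.Ioi j) (by simp)]
      exact Finset.sum_congr rfl fun i _ => Finset.sum_congr rfl fun j _ => hswap _ _
    have h3 : ∀ i : Fin n, ∑ j, |(Z - M.clusterMatrix) i j|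
        = |(Z - M.clusterMatrix) i i| + ∑ j ∈ Finset.Iio i, |(Z - M.clusterMatrix) i j|
          + ∑ j ∈ Finset.Ioi i, |(Z - M.clusterMatrix) i j| := by
      intro i
      have : (Finset.univ : Finset (Fin n)) = insert i (Finset.Iio i ∪ Finset.Ioi i) := by
        ext j; rcases lt_trichotomy j i with h | h | h <;> simp [h]
      rw [this, Finset.sum_insert (by simp), Finset.sum_union, add_assoc]
      exact Finset.disjoint_left.2 fun j hj hj' => by
        simp at hj hj'; exact lt_asymm hj hj'
    simp only [norm1, h3, Finset.sum_add_distrib]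
    rw [h2]; ring
  have hle : ∑ i, ∑ j ∈ Finset.Ioi i,
      |(if 1 / 2 < Z i j then 1 else 0) - M.clusterMatrix i j|
      ≤ 2 * ∑ i, ∑ j ∈ Finset.Ioi i, |(Z - M.clusterMatrix) i j| := by
    simp only [Finset.mul_sum]
    refine Finset.sum_le_sum fun i _ => Finset.sum_le_sum fun j _ => ?_
    rw [Matrix.sub_apply]
    have habs := abs_nonneg (Z i j - M.clusterMatrix i j)
    have hl := le_abs_self (Z i j - M.clusterMatrix i j)
    have hl' := neg_abs_le (Z i j - M.clusterMatrix i j)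
    unfold clusterMatrix at *
    split_ifs at * <;> norm_num <;> norm_num at hl hl' habs <;> linarith
  rw [hsum]
  linarith [Finset.sum_nonneg fun i (_ : i ∈ Finset.univ) => abs_nonneg ((Z - M.clusterMatrix) i i)]

end Model

/-! ### Largest eigenvalues -/

lemma le_largestEigenvalue {d : ℕ} {S : Matrix (Fin d) (Fin d) ℝ} (hS : S.IsHermitian)
    (k : Fin d) : hS.eigenvalues k ≤ largestEigenvalue S := by
  unfold largestEigenvalue
  rw [hS.spectrum_real_eq_range_eigenvalues]
  exact le_csSup (Set.finite_range _).bddAbove ⟨k, rfl⟩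

lemma largestEigenvalue_nonneg {d : ℕ} {S : Matrix (Fin d) (Fin d) ℝ} (hS : S.PosSemidef) :
    0 ≤ largestEigenvalue S := by
  unfold largestEigenvalue
  rw [hS.isHermitian.spectrum_real_eq_range_eigenvalues]
  -- This form of the bound also covers `d = 0`, where the spectrum is empty and its supremum is
  -- `0`.
  refine Real.sSup_nonneg ?_
  rintro _ ⟨k, rfl⟩
  exact hS.eigenvalues_nonneg k

open Matrix in
lemma dotProduct_mulVec_le_largestEigenvalue {d : ℕ} {S : Matrix (Fin d) (Fin d) ℝ}
    (hS : S.IsHermitian) (x : EuclideanSpace ℝ (Fin d)) :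
    x.ofLp ⬝ᵥ S *ᵥ x.ofLp ≤ largestEigenvalue S * ‖x‖ ^ 2 := by
  have h1 : x.ofLp ⬝ᵥ S *ᵥ x.ofLp
      = ∑ k, hS.eigenvalues k * inner ℝ (hS.eigenvectorBasis k) x ^ 2 := by
    have h := hS.eigenvectorBasis.sum_inner_mul_inner x (WithLp.toLp 2 (S *ᵥ x.ofLp))
    have hk : ∀ k, inner ℝ (hS.eigenvectorBasis k) (WithLp.toLp 2 (S *ᵥ x.ofLp))
        = hS.eigenvalues k * inner ℝ (hS.eigenvectorBasis k) x := by
      intro k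
      simp only [EuclideanSpace.inner_eq_star_dotProduct, star_trivial]
      have hsym : Sᵀ = S := by simpa [Matrix.IsHermitian] using hS
      rw [dotProduct_comm, dotProduct_mulVec, ← mulVec_transpose, hsym,
        hS.mulVec_eigenvectorBasis, smul_dotProduct, smul_eq_mul, dotProduct_comm]
    simp only [hk] at h
    rw [EuclideanSpace.inner_eq_star_dotProduct, star_trivial, dotProduct_comm] at h
    rw [← h]
    refine Finset.sum_congr rfl fun k _ => ?_
    rw [real_inner_comm x]; ring
  rw [h1, ← hS.eigenvectorBasis.sum_sq_inner_right x, Finset.mul_sum]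
  exact Finset.sum_le_sum fun k _ =>
    mul_le_mul_of_nonneg_right (le_largestEigenvalue hS k) (sq_nonneg _)

lemma Model.sigma_nonneg {n d K : ℕ} (M : Model n d K) : 0 ≤ M.sigma := Real.sqrt_nonneg _

lemma Model.sum_largestEigenvalue {n d K : ℕ} (M : Model n d K) (hn : 1 ≤ n) :
    ∑ i, largestEigenvalue (M.cov (M.label i)) = n * M.sigma ^ 2 := by
  have hn' : (0 : ℝ) < n := by exact_mod_cast hn
  rw [Model.sigma, M.sum_size_mul (fun k => largestEigenvalue (M.cov k)), Real.sq_sqrt]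
  · field_simp
  · exact mul_nonneg (by positivity)
      (Finset.sum_nonneg fun i _ => largestEigenvalue_nonneg (M.cov_posSemidef _))

/-! ### Moments of sums of independent random variables -/

lemma integrable_pow_of_memLp_four {Ω : Type*} [MeasurableSpace Ω] {P : Measure Ω}
    [IsFiniteMeasure P] {X : Ω → ℝ} (hX : MemLp X 4 P) {k : ℕ} (hk : k ≤ 4) :
    Integrable (fun ω => X ω ^ k) P := by
  have h4 : Integrable (fun ω => ‖X ω‖ ^ 4) P :=
    MemLp.integrable_norm_pow' (p := 4) (by exact_mod_cast hX)
  have h := integrable_norm_pow_of_le hX.aestronglyMeasurable hk h4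
  simp only [← norm_pow] at h
  exact (integrable_norm_iff (hX.aestronglyMeasurable.pow k)).1 h

lemma memLp_four_of_integrable_pow {Ω : Type*} [MeasurableSpace Ω] {P : Measure Ω}
    {X : Ω → ℝ} (hm : AEStronglyMeasurable X P) (h : Integrable (fun ω => X ω ^ 4) P) :
    MemLp X 4 P := by
  rw [← integrable_norm_rpow_iff hm (by norm_num) (by norm_num)]
  refine h.congr (ae_of_all _ fun ω => ?_)
  have : ((4 : ENNReal).toReal) = ((4 : ℕ) : ℝ) := by norm_num
  simp only [this, Real.rpow_natCast, Real.norm_eq_abs]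
  rw [← Even.pow_abs (by decide)]

lemma sq_integral_sq_le {Ω : Type*} [MeasurableSpace Ω] {P : Measure Ω}
    [IsProbabilityMeasure P] {X : Ω → ℝ} (hX : MemLp X 4 P) :
    (∫ ω, X ω ^ 2 ∂P) ^ 2 ≤ ∫ ω, X ω ^ 4 ∂P := by
  have h2 : MemLp (fun ω => X ω ^ 2) 2 P := by
    refine (memLp_two_iff_integrable_sq (hX.aestronglyMeasurable.pow 2)).2 ?_
    simpa only [Pi.pow_apply, ← pow_mul] using integrable_pow_of_memLp_four hX le_rfl
  have h := variance_nonneg (fun ω => X ω ^ 2) P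
  rw [variance_eq_sub h2] at h
  simp only [Pi.pow_apply, ← pow_mul] at h
  linarith

/-- The second and the fourth moment of a sum of independent centered random variables. -/
theorem integral_sum_pow_of_indep {Ω ι : Type*} [MeasurableSpace Ω] {P : Measure Ω}
    [IsProbabilityMeasure P] {X : ι → Ω → ℝ} {a : ι → ℝ}
    (hind : ∀ (s : Finset ι) (i : ι), i ∉ s → IndepFun (fun ω => ∑ j ∈ s, X j ω) (X i) P)
    (hL : ∀ i, MemLp (X i) 4 P) (hmean : ∀ i, ∫ ω, X i ω ∂P = 0) (ha : ∀ i, 0 ≤ a i)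
    (h4 : ∀ i, ∫ ω, X i ω ^ 4 ∂P ≤ a i ^ 2) (s : Finset ι) :
    MemLp (fun ω => ∑ j ∈ s, X j ω) 4 P ∧
    ∫ ω, (∑ j ∈ s, X j ω) ^ 2 ∂P = ∑ j ∈ s, ∫ ω, X j ω ^ 2 ∂P ∧
    ∫ ω, (∑ j ∈ s, X j ω) ^ 4 ∂P ≤ 3 * (∑ j ∈ s, a j) ^ 2 := by
  classical
  have hsq : ∀ i, ∫ ω, X i ω ^ 2 ∂P ≤ a i := fun i =>
    (abs_le_of_sq_le_sq' ((sq_integral_sq_le (hL i)).trans (h4 i)) (ha i)).2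
  have hMem : ∀ s : Finset ι, MemLp (fun ω => ∑ j ∈ s, X j ω) 4 P := fun s =>
    memLp_finsetSum s fun i _ => hL i
  refine ⟨hMem s, ?_⟩
  induction s using Finset.induction_on with
  | empty => simp
  | insert i s hi ih =>
    obtain ⟨ih2, ih4⟩ := ih
    set S : Ω → ℝ := fun ω => ∑ j ∈ s, X j ω with hS
    have hSL : MemLp S 4 P := hMem s
    -- Exponent `0` is allowed so that every term of the binomial expansion is covered. Terms with a
    -- first power vanish by centering.
    have hmix : ∀ p q : ℕ, p ≤ 4 → q ≤ 4 → Integrable (fun ω => S ω ^ p * X i ω ^ q) P ∧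
        ∫ ω, S ω ^ p * X i ω ^ q ∂P = (∫ ω, S ω ^ p ∂P) * ∫ ω, X i ω ^ q ∂P := by
      intro p q hp hq
      have hI : IndepFun (fun ω => S ω ^ p) (fun ω => X i ω ^ q) P :=
        (hind s i hi).comp (φ := fun x => x ^ p) (ψ := fun x => x ^ q)
          (measurable_id.pow_const p) (measurable_id.pow_const q)
      have h1 := integrable_pow_of_memLp_four hSL hp
      have h2 := integrable_pow_of_memLp_four (hL i) hq
      exact ⟨hI.integrable_mul h1 h2,
        hI.integral_fun_mul_eq_mul_integral h1.aestronglyMeasurable h2.aestronglyMeasurable⟩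
    have hSmean : ∫ ω, S ω ∂P = 0 := by
      rw [hS, integral_finsetSum _ fun j _ => (hL j).integrable (by norm_num)]
      exact Finset.sum_eq_zero fun j _ => hmean j
    simp only [Finset.sum_insert hi]
    constructor
    · have e : ∀ ω, (X i ω + S ω) ^ 2 = S ω ^ 0 * X i ω ^ 2 + 2 * (S ω ^ 1 * X i ω ^ 1)
          + S ω ^ 2 * X i ω ^ 0 := fun ω => by ring
      change ∫ ω, (X i ω + S ω) ^ 2 ∂P = _
      simp only [e]
      have i02 := hmix 0 2 (by norm_num) (by norm_num)
      have i11 := hmix 1 1 (by norm_num) (by norm_num)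
      have i20 := hmix 2 0 (by norm_num) (by norm_num)
      rw [integral_add (i02.1.fun_add (i11.1.const_mul 2)) i20.1,
        integral_add i02.1 (i11.1.const_mul 2), integral_const_mul, i02.2, i11.2, i20.2]
      simp only [pow_one, pow_zero, integral_const, hmean, hSmean, ← ih2]
      simp
      rfl
    · have e : ∀ ω, (X i ω + S ω) ^ 4 = S ω ^ 0 * X i ω ^ 4 + 4 * (S ω ^ 1 * X i ω ^ 3)
          + 6 * (S ω ^ 2 * X i ω ^ 2) + 4 * (S ω ^ 3 * X i ω ^ 1) + S ω ^ 4 * X i ω ^ 0 :=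
        fun ω => by ring
      change ∫ ω, (X i ω + S ω) ^ 4 ∂P ≤ _
      simp only [e]
      have i04 := hmix 0 4 (by norm_num) (by norm_num)
      have i13 := hmix 1 3 (by norm_num) (by norm_num)
      have i22 := hmix 2 2 (by norm_num) (by norm_num)
      have i31 := hmix 3 1 (by norm_num) (by norm_num)
      have i40 := hmix 4 0 (by norm_num) (by norm_num)
      rw [integral_add (((i04.1.fun_add (i13.1.const_mul 4)).fun_add (i22.1.const_mul 6)).fun_add
          (i31.1.const_mul 4)) i40.1,
        integral_add ((i04.1.fun_add (i13.1.const_mul 4)).fun_add (i22.1.const_mul 6))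
          (i31.1.const_mul 4),
        integral_add (i04.1.fun_add (i13.1.const_mul 4)) (i22.1.const_mul 6),
        integral_add i04.1 (i13.1.const_mul 4), integral_const_mul, integral_const_mul,
        integral_const_mul, i04.2, i13.2, i22.2, i31.2, i40.2]
      simp only [pow_one, pow_zero, integral_const, hmean, hSmean]
      simp only [probReal_univ, smul_eq_mul, one_mul, mul_one, zero_mul, mul_zero, add_zero]
      have hA : 0 ≤ ∑ j ∈ s, a j := Finset.sum_nonneg fun j _ => ha j
      have hS2 : ∫ ω, S ω ^ 2 ∂P ≤ ∑ j ∈ s, a j :=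
        ih2.trans_le (Finset.sum_le_sum fun j _ => hsq j)
      have hprod : (∫ ω, S ω ^ 2 ∂P) * ∫ ω, X i ω ^ 2 ∂P ≤ (∑ j ∈ s, a j) * a i :=
        mul_le_mul hS2 (hsq i) (integral_nonneg fun ω => sq_nonneg _) hA
      have := h4 i
      -- With `A = ∑ j ∈ s, a j` this is `a i ^ 2 + 6 * A * a i + 3 * A ^ 2 ≤ 3 * (A + a i) ^ 2`.
      nlinarith [sq_nonneg (a i)]

/-- Centering costs at most a factor `16` in the fourth moment. -/
lemma integral_sub_integral_pow_four_le {Ω : Type*} [MeasurableSpace Ω] {P : Measure Ω}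
    [IsProbabilityMeasure P] {X : Ω → ℝ} (hX : MemLp X 4 P) (c : ℝ) :
    ∫ ω, (X ω - ∫ ω', X ω' ∂P) ^ 4 ∂P ≤ 16 * ∫ ω, (X ω - c) ^ 4 ∂P := by
  have hXc : MemLp (fun ω => X ω - c) 4 P := hX.sub (memLp_const c)
  have hXm : MemLp (fun ω => X ω - ∫ ω', X ω' ∂P) 4 P := hX.sub (memLp_const _)
  have hXi : Integrable X P := hX.integrable (by norm_num)
  have hi := integrable_pow_of_memLp_four hXc (le_refl 4)
  set m := ∫ ω', (X ω' - c) ∂P with hm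
  have hmc : ∫ ω', X ω' ∂P = m + c := by
    rw [hm, integral_sub hXi (integrable_const c)]; simp
  have hm4 : m ^ 4 ≤ ∫ ω, (X ω - c) ^ 4 ∂P := by
    have h1 := sq_integral_sq_le hXc
    have h2 : m ^ 2 ≤ ∫ ω, (X ω - c) ^ 2 ∂P := by
      have h := variance_nonneg (fun ω => X ω - c) P
      rw [variance_eq_sub (hXc.mono_exponent (by norm_num))] at h
      simp only [Pi.pow_apply] at h
      linarith
    calc m ^ 4 = (m ^ 2) ^ 2 := by ring
      _ ≤ (∫ ω, (X ω - c) ^ 2 ∂P) ^ 2 := by gcongr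
      _ ≤ _ := h1
  -- Pointwise `(u - m) ^ 4 ≤ 8 * u ^ 4 + 8 * m ^ 4`, and `m ^ 4` is again at most the fourth moment
  -- about `c`.
  calc ∫ ω, (X ω - ∫ ω', X ω' ∂P) ^ 4 ∂P ≤ ∫ ω, (8 * (X ω - c) ^ 4 + 8 * m ^ 4) ∂P := by
        refine integral_mono (integrable_pow_of_memLp_four hXm le_rfl)
          ((hi.const_mul 8).add (integrable_const _)) fun ω => ?_
        simp only [hmc]
        nlinarith [sq_nonneg ((X ω - c) + m), sq_nonneg ((X ω - c) ^ 2 - m ^ 2),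
          sq_nonneg (((X ω - c) + m) * ((X ω - c) - m)), sq_nonneg ((X ω - c) ^ 2 + m ^ 2),
          mul_nonneg (sq_nonneg ((X ω - c) + m)) (sq_nonneg ((X ω - c) + m)),
          mul_nonneg (sq_nonneg ((X ω - c) + m)) (sq_nonneg ((X ω - c) - m)),
          mul_nonneg (sq_nonneg ((X ω - c) + m)) (sq_nonneg ((X ω - c))),
          mul_nonneg (sq_nonneg ((X ω - c) + m)) (sq_nonneg m)]
    _ = 8 * ∫ ω, (X ω - c) ^ 4 ∂P + 8 * m ^ 4 := by
        rw [integral_add (hi.const_mul 8) (integrable_const _), integral_const_mul]; simp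
    _ ≤ _ := by linarith

/-! ### Moments of real Gaussian variables -/

lemma integrable_pow_gaussianReal (k : ℕ) : Integrable (fun x : ℝ => x ^ k) (gaussianReal 0 1) := by
  have h : Integrable (fun x : ℝ => ‖id x‖ ^ k) (gaussianReal 0 1) :=
    MemLp.integrable_norm_pow' (memLp_id_gaussianReal' _ (by simp))
  simp only [id, ← norm_pow] at h
  exact (integrable_norm_iff (by fun_prop)).1 h

lemma integral_pow_gaussianReal (k : ℕ) :
    ∫ x, x ^ k ∂gaussianReal 0 1 = iteratedDeriv k (fun t : ℝ => Real.exp (t ^ 2 / 2)) 0 := by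
  have h := iteratedDeriv_mgf_zero (X := id) (μ := gaussianReal 0 1)
    (by rw [integrableExpSet_id_gaussianReal]; simp) k
  rw [mgf_id_gaussianReal] at h
  simpa using h.symm

lemma hasDerivAt_mul_exp_sq {g : ℝ → ℝ} {g' t : ℝ} (hg : HasDerivAt g g' t) :
    HasDerivAt (fun t => g t * Real.exp (t ^ 2 / 2)) ((g' + t * g t) * Real.exp (t ^ 2 / 2)) t := by
  have h : HasDerivAt (fun t : ℝ => Real.exp (t ^ 2 / 2)) (Real.exp (t ^ 2 / 2) * t) t := by
    have := ((hasDerivAt_pow 2 t).div_const 2).exp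
    convert this using 2
    simp
  exact (hg.fun_mul h).congr_deriv (by ring)

/-- Iterating `g ↦ g' + t * g` from `g = 1` yields the derivatives of the moment generating
function, hence the moments. -/
lemma deriv_mul_exp_sq {g g' : ℝ → ℝ} (hg : ∀ t, HasDerivAt g (g' t) t) :
    deriv (fun t => g t * Real.exp (t ^ 2 / 2))
      = fun t => (g' t + t * g t) * Real.exp (t ^ 2 / 2) :=
  funext fun t => (hasDerivAt_mul_exp_sq (hg t)).deriv

lemma gaussianReal_moments :
    ∫ x, x ∂gaussianReal 0 1 = 0 ∧ ∫ x, x ^ 2 ∂gaussianReal 0 1 = 1 ∧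
    ∫ x, x ^ 3 ∂gaussianReal 0 1 = 0 ∧ ∫ x, x ^ 4 ∂gaussianReal 0 1 = 3 := by
  have d0 : iteratedDeriv 0 (fun t : ℝ => Real.exp (t ^ 2 / 2))
      = fun t => 1 * Real.exp (t ^ 2 / 2) := by simp
  have d1 : iteratedDeriv 1 (fun t : ℝ => Real.exp (t ^ 2 / 2))
      = fun t => t * Real.exp (t ^ 2 / 2) := by
    rw [iteratedDeriv_succ, d0, deriv_mul_exp_sq (g' := fun _ => 0) fun t => hasDerivAt_const t 1]
    simp
  have d2 : iteratedDeriv 2 (fun t : ℝ => Real.exp (t ^ 2 / 2))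
      = fun t => (1 + t ^ 2) * Real.exp (t ^ 2 / 2) := by
    rw [iteratedDeriv_succ, d1, deriv_mul_exp_sq (g' := fun _ => 1) fun t => hasDerivAt_id' t]
    simp only [pow_two]
  have d3 : iteratedDeriv 3 (fun t : ℝ => Real.exp (t ^ 2 / 2))
      = fun t => (3 * t + t ^ 3) * Real.exp (t ^ 2 / 2) := by
    rw [iteratedDeriv_succ, d2, deriv_mul_exp_sq (g' := fun t => 2 * t) fun t => by
      simpa using (hasDerivAt_pow 2 t).const_add 1]
    ext t; ring
  have d4 : iteratedDeriv 4 (fun t : ℝ => Real.exp (t ^ 2 / 2))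
      = fun t => (3 + 6 * t ^ 2 + t ^ 4) * Real.exp (t ^ 2 / 2) := by
    rw [iteratedDeriv_succ, d3, deriv_mul_exp_sq (g' := fun t => 3 + 3 * t ^ 2) fun t => by
      simpa using ((hasDerivAt_id' t).const_mul 3).fun_add (hasDerivAt_pow 3 t)]
    ext t; ring
  refine ⟨?_, ?_, ?_, ?_⟩
  · simpa only [d1, pow_one, zero_mul] using integral_pow_gaussianReal 1
  · simpa [d2] using integral_pow_gaussianReal 2
  · simpa [d3] using integral_pow_gaussianReal 3
  · simpa [d4] using integral_pow_gaussianReal 4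

lemma gaussianReal_eq_map (m : ℝ) (v : ℝ≥0) :
    gaussianReal m v = (gaussianReal 0 1).map (fun x => m + Real.sqrt v * x) := by
  have h : (fun x => m + Real.sqrt v * x) = (fun x => m + x) ∘ (fun x => Real.sqrt v * x) := rfl
  rw [h, ← Measure.map_map (by fun_prop) (by fun_prop), gaussianReal_map_const_mul,
    gaussianReal_map_const_add]
  congr 1
  · simp
  · ext; simp

/-- The first, second and fourth moments of the centered square of a real Gaussian variable. -/
lemma exists_moments_sq_gaussianReal : ∃ D : ℝ, 0 ≤ D ∧ ∀ (m : ℝ) (v : ℝ≥0),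
    MemLp (fun x => x ^ 2 - m ^ 2 - v) 4 (gaussianReal m v) ∧
    ∫ x, (x ^ 2 - m ^ 2 - v) ∂gaussianReal m v = 0 ∧
    ∫ x, (x ^ 2 - m ^ 2 - v) ^ 2 ∂gaussianReal m v ≤ 4 * v * (m ^ 2 + v) ∧
    ∫ x, (x ^ 2 - m ^ 2 - v) ^ 4 ∂gaussianReal m v ≤ (D * v * (m ^ 2 + v)) ^ 2 := by
  obtain ⟨m1, m2, m3, m4⟩ := gaussianReal_moments
  set ν := gaussianReal 0 1 with hν
  set κ := ∫ x, (x ^ 2 - 1) ^ 4 ∂ν with hκ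
  have hκ0 : 0 ≤ κ := integral_nonneg fun x => by positivity
  have I : ∀ k, Integrable (fun x : ℝ => x ^ k) ν := integrable_pow_gaussianReal
  have I1 : Integrable (fun x : ℝ => x) ν := by simpa using I 1
  have m1' : ∀ c : ℝ, ∫ x, c * x ∂ν = 0 := fun c =>
    (integral_const_mul c _).trans (by rw [m1, mul_zero])
  have I21 : Integrable (fun x : ℝ => x ^ 2 - 1) ν := (I 2).sub (integrable_const 1)
  have Iκ : Integrable (fun x : ℝ => (x ^ 2 - 1) ^ 4) ν := by
    have e : (fun x : ℝ => (x ^ 2 - 1) ^ 4)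
        = fun x => x ^ 8 - 4 * x ^ 6 + 6 * x ^ 4 - 4 * x ^ 2 + 1 := by ext; ring
    rw [e]
    exact ((((I 8).sub ((I 6).const_mul 4)).add ((I 4).const_mul 6)).sub ((I 2).const_mul 4)).add
      (integrable_const 1)
  -- From `(a + b) ^ 4 ≤ 8 * a ^ 4 + 8 * b ^ 4` with `a = 2 * m * s * x`: `384 = 8 * 2 ^ 4 * 3`,
  -- where 3 is the fourth moment of a standard Gaussian.
  refine ⟨Real.sqrt (384 + 8 * κ), Real.sqrt_nonneg _, fun m v => ?_⟩
  set s := Real.sqrt v with hs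
  have hs0 : 0 ≤ s := Real.sqrt_nonneg _
  have hs2 : s ^ 2 = v := Real.sq_sqrt v.2
  have hmeas : AEMeasurable (fun x => m + s * x) ν := by fun_prop
  have hT : ∀ x : ℝ, (m + s * x) ^ 2 - m ^ 2 - (v : ℝ)
      = 2 * m * s * x + s ^ 2 * (x ^ 2 - 1) := fun x => by rw [← hs2]; ring
  have IT4 : Integrable (fun x : ℝ => (2 * m * s * x + s ^ 2 * (x ^ 2 - 1)) ^ 4) ν := by
    have e : (fun x : ℝ => (2 * m * s * x + s ^ 2 * (x ^ 2 - 1)) ^ 4)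
      = fun x => (16 * m ^ 4 * s ^ 4) * x ^ 4 + (32 * m ^ 3 * s ^ 5) * x ^ 5
        + (-(32 * m ^ 3 * s ^ 5)) * x ^ 3 + (24 * m ^ 2 * s ^ 6) * x ^ 6
        + (-(48 * m ^ 2 * s ^ 6)) * x ^ 4 + (24 * m ^ 2 * s ^ 6) * x ^ 2
        + (8 * m * s ^ 7) * x ^ 7 + (-(24 * m * s ^ 7)) * x ^ 5 + (24 * m * s ^ 7) * x ^ 3
        + (-(8 * m * s ^ 7)) * x + s ^ 8 * (x ^ 2 - 1) ^ 4 := by ext; ring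
    rw [e]
    exact ((((((((((I 4).const_mul _).add ((I 5).const_mul _)).add ((I 3).const_mul _)).add
      ((I 6).const_mul _)).add ((I 4).const_mul _)).add ((I 2).const_mul _)).add
      ((I 7).const_mul _)).add ((I 5).const_mul _)).add ((I 3).const_mul _)).add
      (I1.const_mul _) |>.add (Iκ.const_mul _)
  have hmap : ∀ k : ℕ, ∫ x, (x ^ 2 - m ^ 2 - (v : ℝ)) ^ k ∂gaussianReal m v
      = ∫ x, (2 * m * s * x + s ^ 2 * (x ^ 2 - 1)) ^ k ∂ν := by
    intro k
    rw [gaussianReal_eq_map, integral_map hmeas (by fun_prop)]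
    simp only [hT]
  refine ⟨?_, ?_, ?_, ?_⟩
  · refine memLp_four_of_integrable_pow (by fun_prop) ?_
    rw [gaussianReal_eq_map, integrable_map_measure (by fun_prop) hmeas]
    simpa only [Function.comp_def, ← hs, hT] using IT4
  · have := hmap 1
    simp only [pow_one] at this
    rw [this, integral_add (I1.const_mul _) (I21.const_mul _),
      m1', integral_const_mul, integral_sub (I 2) (integrable_const 1), m2]
    simp
  · rw [hmap 2]
    have e : (fun x : ℝ => (2 * m * s * x + s ^ 2 * (x ^ 2 - 1)) ^ 2)
      = fun x => (4 * m ^ 2 * s ^ 2 - 2 * s ^ 4) * x ^ 2 + (4 * m * s ^ 3) * x ^ 3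
        + (-(4 * m * s ^ 3)) * x + s ^ 4 * x ^ 4 + s ^ 4 := by ext; ring
    rw [e, integral_add (((((I 2).const_mul _).fun_add ((I 3).const_mul _)).fun_add
        (I1.const_mul _)).fun_add ((I 4).const_mul _)) (integrable_const _),
      integral_add ((((I 2).const_mul _).fun_add ((I 3).const_mul _)).fun_add (I1.const_mul _))
        ((I 4).const_mul _),
      integral_add (((I 2).const_mul _).fun_add ((I 3).const_mul _)) (I1.const_mul _),
      integral_add ((I 2).const_mul _) ((I 3).const_mul _), m1']
    simp only [integral_const_mul, m2, m3, m4, integral_const, probReal_univ, one_smul]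
    rw [← hs2]
    nlinarith [sq_nonneg (s ^ 2)]
  · rw [hmap 4, mul_assoc (Real.sqrt _), mul_pow (Real.sqrt _),
      Real.sq_sqrt (show 0 ≤ 384 + 8 * κ by positivity), ← hs2]
    calc ∫ x, (2 * m * s * x + s ^ 2 * (x ^ 2 - 1)) ^ 4 ∂ν
        ≤ ∫ x, ((128 * m ^ 4 * s ^ 4) * x ^ 4 + (8 * s ^ 8) * (x ^ 2 - 1) ^ 4) ∂ν := by
          refine integral_mono IT4 (((I 4).const_mul _).add (Iκ.const_mul _)) fun x => ?_
          have hc : ∀ a b : ℝ, (a + b) ^ 4 ≤ 8 * a ^ 4 + 8 * b ^ 4 := fun a b => by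
            nlinarith [sq_nonneg (a ^ 2 - b ^ 2), sq_nonneg (a - b), sq_nonneg (a + b),
              mul_nonneg (sq_nonneg (a - b)) (sq_nonneg (a - b)),
              mul_nonneg (sq_nonneg (a + b)) (sq_nonneg (a - b))]
          refine (hc _ _).trans (le_of_eq ?_)
          ring
      _ = 384 * m ^ 4 * s ^ 4 + 8 * s ^ 8 * κ := by
          rw [integral_add ((I 4).const_mul _) (Iκ.const_mul _), integral_const_mul,
            integral_const_mul, m4]
          ring
      _ ≤ (384 + 8 * κ) * (s ^ 2 * (m ^ 2 + s ^ 2)) ^ 2 := by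
          have h1 : 0 ≤ s ^ 6 * m ^ 2 := by positivity
          have h2 : 0 ≤ s ^ 8 := by positivity
          have h3 : 0 ≤ s ^ 4 * m ^ 4 := by positivity
          have h4 := mul_nonneg hκ0 h1
          have h5 := mul_nonneg hκ0 h3
          nlinarith

/-! ### The norm of a Gaussian vector -/

section Coordinates

variable {d : ℕ} {S : Matrix (Fin d) (Fin d) ℝ} (hS : S.PosSemidef)
  (m : EuclideanSpace ℝ (Fin d))

open Matrix in
include hS in
lemma covariance_inner_eigenvectorBasis (k l : Fin d) :
    cov[fun w => inner ℝ (hS.isHermitian.eigenvectorBasis k) w,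
        fun w => inner ℝ (hS.isHermitian.eigenvectorBasis l) w; multivariateGaussian m S]
      = if k = l then hS.isHermitian.eigenvalues l else 0 := by
  rw [← covarianceBilin_apply_eq_cov IsGaussian.memLp_two_id,
    covarianceBilin_multivariateGaussian hS, hS.isHermitian.mulVec_eigenvectorBasis,
    dotProduct_smul, smul_eq_mul]
  have h := hS.isHermitian.eigenvectorBasis.inner_eq_ite l k
  rw [EuclideanSpace.inner_eq_star_dotProduct, star_trivial] at h
  rw [h]
  simp [eq_comm]

lemma hasGaussianLaw_eigenvectorBasis :
    HasGaussianLaw (fun (w : EuclideanSpace ℝ (Fin d)) k =>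
      inner ℝ (hS.isHermitian.eigenvectorBasis k) w) (multivariateGaussian m S) :=
  IsGaussian.hasGaussianLaw_id.map_fun
    (ContinuousLinearMap.pi fun k => innerSL ℝ (hS.isHermitian.eigenvectorBasis k))

/-- Jointly Gaussian and uncorrelated, hence independent. -/
lemma iIndepFun_eigenvectorBasis :
    iIndepFun (fun k (w : EuclideanSpace ℝ (Fin d)) =>
      inner ℝ (hS.isHermitian.eigenvectorBasis k) w) (multivariateGaussian m S) :=
  (hasGaussianLaw_eigenvectorBasis hS m).iIndepFun_of_covariance_eq_zero fun k l hkl => by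
    rw [covariance_inner_eigenvectorBasis hS, if_neg hkl]

lemma map_inner_eigenvectorBasis (k : Fin d) :
    (multivariateGaussian m S).map (fun w => inner ℝ (hS.isHermitian.eigenvectorBasis k) w)
      = gaussianReal (inner ℝ (hS.isHermitian.eigenvectorBasis k) m)
        (hS.isHermitian.eigenvalues k).toNNReal := by
  have h := ((hasGaussianLaw_eigenvectorBasis hS m).eval k).map_eq_gaussianReal
  rw [h, ← covariance_self (by fun_prop), covariance_inner_eigenvectorBasis hS, if_pos rfl]
  congr 1
  have := (innerSL ℝ (hS.isHermitian.eigenvectorBasis k)).integral_comp_id_comm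
    (μ := multivariateGaussian m S) IsGaussian.integrable_id
  simp only [integral_id_multivariateGaussian] at this
  exact this

end Coordinates

lemma memLp_norm_multivariateGaussian {d : ℕ} (m : EuclideanSpace ℝ (Fin d))
    (S : Matrix (Fin d) (Fin d) ℝ) : MemLp (fun w => ‖w‖) 4 (multivariateGaussian m S) :=
  (IsGaussian.memLp_id (multivariateGaussian m S) 4 (by simp)).norm

/-- Concentration of the norm of a Gaussian vector, with bounds that only depend on the largest
eigenvalue of the covariance matrix. -/
theorem exists_norm_concentration : ∃ D : ℝ, 0 ≤ D ∧
    ∀ (d : ℕ) (m : EuclideanSpace ℝ (Fin d)) (S : Matrix (Fin d) (Fin d) ℝ), S.PosSemidef →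
    ∃ c : ℝ, 0 ≤ c ∧
      ∫ w, (‖w‖ - c) ^ 2 ∂multivariateGaussian m S ≤ 4 * largestEigenvalue S ∧
      ∫ w, (‖w‖ - c) ^ 4 ∂multivariateGaussian m S ≤ D * largestEigenvalue S ^ 2 := by
  obtain ⟨D, hD, hmom⟩ := exists_moments_sq_gaussianReal
  refine ⟨4 + 3 * D ^ 2, by positivity, fun d m S hS => ?_⟩
  set ρ := largestEigenvalue S with hρdef
  have hρ : 0 ≤ ρ := largestEigenvalue_nonneg hS
  set b := hS.isHermitian.eigenvectorBasis with hb
  set μ : Fin d → ℝ := fun k => inner ℝ (b k) m with hμ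
  set v : Fin d → ℝ≥0 := fun k => (hS.isHermitian.eigenvalues k).toNNReal with hv
  have hvρ : ∀ k, (v k : ℝ) ≤ ρ := fun k => by
    rw [hv, Real.coe_toNNReal _ (hS.eigenvalues_nonneg k)]
    exact le_largestEigenvalue hS.isHermitian k
  set ν := multivariateGaussian m S with hν
  set X : Fin d → EuclideanSpace ℝ (Fin d) → ℝ :=
    fun k w => inner ℝ (b k) w ^ 2 - μ k ^ 2 - v k with hX
  have hZm : ∀ k, AEMeasurable (fun w : EuclideanSpace ℝ (Fin d) => inner ℝ (b k) w) ν :=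
    fun k => by fun_prop
  have hmap : ∀ k, ν.map (fun w => inner ℝ (b k) w) = gaussianReal (μ k) (v k) :=
    map_inner_eigenvectorBasis hS m
  have hint : ∀ k (p : ℕ), ∫ w, X k w ^ p ∂ν
      = ∫ x, (x ^ 2 - μ k ^ 2 - v k) ^ p ∂gaussianReal (μ k) (v k) := fun k p => by
    rw [← hmap k, integral_map (hZm k) (by fun_prop)]
  have hindep : iIndepFun X ν :=
    (iIndepFun_eigenvectorBasis hS m).comp (fun k x => x ^ 2 - μ k ^ 2 - v k)
      (fun k => by fun_prop)
  have hXL : ∀ k, MemLp (X k) 4 ν := fun k => by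
    have h := (hmom (μ k) (v k)).1
    rw [← hmap k] at h
    exact h.comp_of_map (hZm k)
  have hXmean : ∀ k, ∫ w, X k w ∂ν = 0 := fun k => by
    have h := hint k 1
    simp only [pow_one] at h
    rw [h, (hmom (μ k) (v k)).2.1]
  obtain ⟨hL, h2, h4⟩ := integral_sum_pow_of_indep (P := ν) (X := X)
    (a := fun k => D * v k * (μ k ^ 2 + v k))
    (fun s i hi => by
      have h := hindep.indepFun_finsetSum_of_notMem₀ (fun k => (hXL k).aemeasurable) hi
      rwa [show (∑ j ∈ s, X j) = fun ω => ∑ j ∈ s, X j ω from by ext; simp] at h)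
    hXL hXmean (fun k => by positivity)
    (fun k => by rw [hint k 4]; exact (hmom (μ k) (v k)).2.2.2) Finset.univ
  set c2 := ∑ k, (μ k ^ 2 + (v k : ℝ)) with hc2
  have hc2n : 0 ≤ c2 := Finset.sum_nonneg fun k _ => by positivity
  have hsum : ∀ w, ∑ k, X k w = ‖w‖ ^ 2 - c2 := fun w => by
    simp only [hX, hc2, sub_sub]
    rw [Finset.sum_sub_distrib, b.sum_sq_inner_right]
  simp only [hsum] at hL h2 h4
  -- Only one factor `v k` is estimated by `ρ`; the rest sums to `c2`, the mean of `‖w‖ ^ 2`. This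
  -- keeps the dimension out of the bounds.
  have hvsum : ∑ k, (v k : ℝ) * (μ k ^ 2 + v k) ≤ ρ * c2 := by
    rw [hc2, Finset.mul_sum]
    exact Finset.sum_le_sum fun k _ => mul_le_mul_of_nonneg_right (hvρ k) (by positivity)
  have h2' : ∫ w, (‖w‖ ^ 2 - c2) ^ 2 ∂ν ≤ 4 * ρ * c2 := by
    rw [h2]
    calc ∑ k, ∫ w, X k w ^ 2 ∂ν ≤ ∑ k, 4 * ((v k : ℝ) * (μ k ^ 2 + v k)) :=
          Finset.sum_le_sum fun k _ => by
            rw [hint k 2, ← mul_assoc]; exact (hmom (μ k) (v k)).2.2.1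
      _ ≤ _ := by rw [← Finset.mul_sum]; linarith
  have h4' : ∫ w, (‖w‖ ^ 2 - c2) ^ 4 ∂ν ≤ 3 * (D * (ρ * c2)) ^ 2 := by
    refine h4.trans ?_
    have e : ∑ k, D * (v k : ℝ) * (μ k ^ 2 + v k) = D * ∑ k, (v k : ℝ) * (μ k ^ 2 + v k) := by
      simp only [Finset.mul_sum, mul_assoc]
    rw [e]
    have : 0 ≤ ∑ k, (v k : ℝ) * (μ k ^ 2 + v k) := Finset.sum_nonneg fun k _ => by positivity
    gcongr
  have hnorm := memLp_norm_multivariateGaussian m S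
  refine ⟨Real.sqrt c2, Real.sqrt_nonneg _, ?_⟩
  set c := Real.sqrt c2 with hc
  have hc0 : 0 ≤ c := Real.sqrt_nonneg _
  have hcc : c ^ 2 = c2 := Real.sq_sqrt hc2n
  rcases hc2n.eq_or_lt with h0 | hpos
  · have hc00 : c = 0 := by rw [hc, ← h0, Real.sqrt_zero]
    have h1 : ∫ w, ‖w‖ ^ 2 ∂ν = 0 := by
      have : ∫ w, ∑ k, X k w ∂ν = 0 := by
        rw [integral_finsetSum _ fun k _ => (hXL k).integrable (by norm_num)]
        exact Finset.sum_eq_zero fun k _ => hXmean k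
      simpa only [hsum, ← h0, sub_zero] using this
    simp only [hc00, sub_zero]
    refine ⟨h1.trans_le (by positivity), ?_⟩
    simp only [← h0, sub_zero, mul_zero, ← pow_mul] at h2'
    exact h2'.trans (by positivity)
  -- Passing from `‖w‖ ^ 2` to `‖w‖` gains the factor `(‖w‖ + c) ^ 2 ≥ c2`, which cancels the `c2`
  -- in the moment bounds.
  · have hfac : ∀ w : EuclideanSpace ℝ (Fin d), (‖w‖ - c) ^ 2 * c2 ≤ (‖w‖ ^ 2 - c2) ^ 2 := by
      intro w
      have h : (‖w‖ ^ 2 - c2) ^ 2 = (‖w‖ - c) ^ 2 * (‖w‖ + c) ^ 2 := by rw [← hcc]; ring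
      rw [h]
      refine mul_le_mul_of_nonneg_left ?_ (sq_nonneg _)
      rw [← hcc]
      exact pow_le_pow_left₀ hc0 (by linarith [norm_nonneg w]) 2
    have hfac4 : ∀ w : EuclideanSpace ℝ (Fin d),
        (‖w‖ - c) ^ 4 * c2 ^ 2 ≤ (‖w‖ ^ 2 - c2) ^ 4 := by
      intro w
      have h := pow_le_pow_left₀ (by positivity) (hfac w) 2
      calc _ = ((‖w‖ - c) ^ 2 * c2) ^ 2 := by ring
        _ ≤ _ := h
        _ = _ := by ring
    have hLc : MemLp (fun w => ‖w‖ - c) 4 ν := hnorm.sub (memLp_const c)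
    constructor
    · have h := integral_mono ((integrable_pow_of_memLp_four hLc (by norm_num)).mul_const c2)
        (integrable_pow_of_memLp_four hL (by norm_num)) hfac
      simp only [integral_mul_const] at h
      exact le_of_mul_le_mul_right (h.trans h2') hpos
    · have h := integral_mono ((integrable_pow_of_memLp_four hLc le_rfl).mul_const (c2 ^ 2))
        (integrable_pow_of_memLp_four hL le_rfl) hfac4
      simp only [integral_mul_const] at h
      refine le_of_mul_le_mul_right (h.trans (h4'.trans ?_)) (by positivity : 0 < c2 ^ 2)
      have : 0 ≤ ρ ^ 2 * c2 ^ 2 := by positivity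
      nlinarith

/-! ### Concentration of the affinities -/

-- Evaluate both quadratic forms at a unit eigenvector of `S + T`.
open Matrix in
lemma largestEigenvalue_add_le {d : ℕ} {S T : Matrix (Fin d) (Fin d) ℝ} (hS : S.PosSemidef)
    (hT : T.PosSemidef) :
    largestEigenvalue (S + T) ≤ largestEigenvalue S + largestEigenvalue T := by
  have hST := (hS.add hT).isHermitian
  rw [largestEigenvalue, hST.spectrum_real_eq_range_eigenvalues]
  refine Real.sSup_le ?_ (add_nonneg (largestEigenvalue_nonneg hS) (largestEigenvalue_nonneg hT))
  rintro _ ⟨k, rfl⟩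
  set b := hST.eigenvectorBasis k with hb
  have hb1 : ‖b‖ = 1 := hST.eigenvectorBasis.orthonormal.1 k
  have h1 : b.ofLp ⬝ᵥ (S + T) *ᵥ b.ofLp = hST.eigenvalues k := by
    rw [hST.mulVec_eigenvectorBasis, dotProduct_smul, smul_eq_mul]
    have h := hST.eigenvectorBasis.inner_eq_one k
    rw [EuclideanSpace.inner_eq_star_dotProduct, star_trivial] at h
    rw [h, mul_one]
  rw [add_mulVec, dotProduct_add] at h1
  have hS' := dotProduct_mulVec_le_largestEigenvalue hS.isHermitian b
  have hT' := dotProduct_mulVec_le_largestEigenvalue hT.isHermitian b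
  rw [hb1] at hS' hT'
  linarith

/-- The difference of two independent Gaussian vectors is Gaussian. -/
lemma map_sub_multivariateGaussian {Ω : Type*} [MeasurableSpace Ω] {P : Measure Ω}
    [IsProbabilityMeasure P] {d : ℕ} {X Y : Ω → EuclideanSpace ℝ (Fin d)}
    {m₁ m₂ : EuclideanSpace ℝ (Fin d)} {S T : Matrix (Fin d) (Fin d) ℝ} (hS : S.PosSemidef)
    (hT : T.PosSemidef) (hX : HasLaw X (multivariateGaussian m₁ S) P)
    (hY : HasLaw Y (multivariateGaussian m₂ T) P) (hXY : IndepFun X Y P) :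
    HasLaw (fun ω => X ω - Y ω) (multivariateGaussian (m₁ - m₂) (S + T)) P := by
  have hXm := hX.aemeasurable
  have hYm := hY.aemeasurable
  refine ⟨by fun_prop, ?_⟩
  refine Measure.ext_of_charFun ?_
  ext t
  have hneg : IndepFun X (fun ω => (-1 : ℝ) • Y ω) P :=
    hXY.comp (φ := id) (ψ := fun y => (-1 : ℝ) • y) measurable_id (by fun_prop)
  have e : (fun ω => X ω - Y ω) = fun ω => X ω + (-1 : ℝ) • Y ω := by
    ext ω; simp [sub_eq_add_neg]
  rw [e, hneg.charFun_map_fun_add_eq_mul hXm (by fun_prop), Pi.mul_apply,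
    charFun_map_smul_comp hYm, hX.map_eq, hY.map_eq, charFun_multivariateGaussian hS,
    charFun_multivariateGaussian hT, charFun_multivariateGaussian (hS.add hT), ← Complex.exp_add]
  congr 1
  simp [inner_sub_right, Matrix.add_mulVec, Matrix.mulVec_neg]
  ring

lemma continuous_affinity_entry {d : ℕ} {f : ℝ≥0 → ℝ} {l : ℝ≥0} (hlip : LipschitzWith l f) :
    Continuous fun w : EuclideanSpace ℝ (Fin d) => f ‖w‖₊ :=
  hlip.continuous.comp continuous_nnnorm

lemma continuous_affinity {n d : ℕ} {f : ℝ≥0 → ℝ} {l : ℝ≥0} (hlip : LipschitzWith l f) (i j : Fin n) :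
    Continuous fun x : Fin n → EuclideanSpace ℝ (Fin d) => affinity f x i j :=
  (continuous_affinity_entry hlip).comp (by fun_prop : Continuous
    fun x : Fin n → EuclideanSpace ℝ (Fin d) => x i - x j)

lemma memLp_affinity_entry {d : ℕ} {f : ℝ≥0 → ℝ} {l : ℝ≥0} (hlip : LipschitzWith l f)
    (hf : ∀ h, f h ∈ Set.Icc (0 : ℝ) 1) (ν : Measure (EuclideanSpace ℝ (Fin d)))
    [IsFiniteMeasure ν] : MemLp (fun w => f ‖w‖₊) 4 ν :=
  MemLp.of_bound (continuous_affinity_entry hlip).aestronglyMeasurable 1 (ae_of_all _ fun w => by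
    rw [Real.norm_eq_abs, abs_le]
    constructor <;> linarith [(hf ‖w‖₊).1, (hf ‖w‖₊).2])

lemma abs_sub_le_of_lipschitz {d : ℕ} {f : ℝ≥0 → ℝ} {l : ℝ≥0} (hlip : LipschitzWith l f)
    (w : EuclideanSpace ℝ (Fin d)) {c : ℝ} (hc : 0 ≤ c) :
    |f ‖w‖₊ - f c.toNNReal| ≤ l * |‖w‖ - c| := by
  have h := hlip.dist_le_mul ‖w‖₊ c.toNNReal
  rwa [Real.dist_eq, NNReal.dist_eq, coe_nnnorm, Real.coe_toNNReal _ hc] at h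

/-- Concentration of a Lipschitz function of the norm of a Gaussian vector. -/
lemma exists_affinity_concentration : ∃ D : ℝ, 0 ≤ D ∧
    ∀ (d : ℕ) (m : EuclideanSpace ℝ (Fin d)) (S : Matrix (Fin d) (Fin d) ℝ), S.PosSemidef →
    ∀ (f : ℝ≥0 → ℝ) (l : ℝ≥0), (∀ h, f h ∈ Set.Icc (0 : ℝ) 1) → LipschitzWith l f →
      ∫ w, |f ‖w‖₊ - ∫ w', f ‖w'‖₊ ∂multivariateGaussian m S| ∂multivariateGaussian m S
        ≤ 2 * l * Real.sqrt (largestEigenvalue S) ∧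
      ∫ w, (f ‖w‖₊ - ∫ w', f ‖w'‖₊ ∂multivariateGaussian m S) ^ 4 ∂multivariateGaussian m S
        ≤ (D * l ^ 2 * largestEigenvalue S) ^ 2 := by
  obtain ⟨D, hD, h⟩ := exists_norm_concentration
  refine ⟨Real.sqrt (16 * D), Real.sqrt_nonneg _, fun d m S hS f l hf hlip => ?_⟩
  obtain ⟨c, hc, h2, h4⟩ := h d m S hS
  set ρ := largestEigenvalue S with hρdef
  have hρ : 0 ≤ ρ := largestEigenvalue_nonneg hS
  set ν := multivariateGaussian m S with hν
  have hφ : MemLp (fun w : EuclideanSpace ℝ (Fin d) => f ‖w‖₊) 4 ν :=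
    memLp_affinity_entry hlip hf ν
  set φ : EuclideanSpace ℝ (Fin d) → ℝ := fun w => f ‖w‖₊ with hφdef
  set a := f c.toNNReal with ha
  have hφa : MemLp (fun w => φ w - a) 4 ν := hφ.sub (memLp_const a)
  have hφm : MemLp (fun w => φ w - ∫ w', φ w' ∂ν) 4 ν := hφ.sub (memLp_const _)
  have hLc : MemLp (fun w => ‖w‖ - c) 4 ν :=
    (memLp_norm_multivariateGaussian m S).sub (memLp_const c)
  have hpow : ∀ k ≤ 4, Even k → ∫ w, (φ w - a) ^ k ∂ν ≤ l ^ k * ∫ w, (‖w‖ - c) ^ k ∂ν := by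
    intro k hk hke
    rw [← integral_const_mul]
    refine integral_mono (integrable_pow_of_memLp_four hφa hk)
      ((integrable_pow_of_memLp_four hLc hk).const_mul _) fun w => ?_
    have := pow_le_pow_left₀ (abs_nonneg _) (abs_sub_le_of_lipschitz hlip w hc) k
    rwa [mul_pow, hke.pow_abs, hke.pow_abs] at this
  constructor
  · have hvar : (∫ w, |φ w - ∫ w', φ w' ∂ν| ∂ν) ^ 2 ≤ ∫ w, (φ w - a) ^ 2 ∂ν := by
      have h1 := variance_nonneg (fun w => |φ w - ∫ w', φ w' ∂ν|) ν
      have habs : MemLp (fun w => |φ w - ∫ w', φ w' ∂ν|) 2 ν :=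
        hφm.abs.mono_exponent (by norm_num)
      rw [variance_eq_sub habs] at h1
      simp only [Pi.pow_apply, sq_abs] at h1
      -- The mean minimizes the quadratic deviation, so recentering from `a` costs nothing here.
      have h3 : ∫ w, (φ w - ∫ w', φ w' ∂ν) ^ 2 ∂ν ≤ ∫ w, (φ w - a) ^ 2 ∂ν := by
        rw [← variance_eq_integral hφ.aemeasurable,
          ← variance_sub_const hφ.aestronglyMeasurable a]
        exact variance_le_expectation_sq hφa.aestronglyMeasurable
      linarith
    have h3 := hpow 2 (by norm_num) (by decide)
    refine (abs_le_of_sq_le_sq' (b := 2 * l * Real.sqrt ρ) ?_ (by positivity)).2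
    rw [mul_pow, mul_pow, Real.sq_sqrt hρ]
    have : (l : ℝ) ^ 2 * ∫ w, (‖w‖ - c) ^ 2 ∂ν ≤ l ^ 2 * (4 * ρ) := by gcongr
    linarith
  · have h3 := hpow 4 (by norm_num) (by decide)
    have h5 := integral_sub_integral_pow_four_le hφ a
    rw [mul_pow, mul_pow, Real.sq_sqrt (by positivity)]
    have : (l : ℝ) ^ 4 * ∫ w, (‖w‖ - c) ^ 4 ∂ν ≤ l ^ 4 * (D * ρ ^ 2) := by gcongr
    calc _ ≤ 16 * ∫ w, (φ w - a) ^ 4 ∂ν := h5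
      _ ≤ 16 * (l ^ 4 * (D * ρ ^ 2)) := by linarith
      _ = _ := by ring

namespace Model

variable {n d K : ℕ} (M : Model n d K)

instance : IsProbabilityMeasure M.law := by unfold law; infer_instance

lemma hasLaw_eval (i : Fin n) : HasLaw (fun x : Fin n → EuclideanSpace ℝ (Fin d) => x i)
    (multivariateGaussian (M.mean (M.label i)) (M.cov (M.label i))) M.law :=
  ⟨(measurable_pi_apply i).aemeasurable, (measurePreserving_eval _ i).map_eq⟩

lemma iIndepFun_eval : iIndepFun (fun i (x : Fin n → EuclideanSpace ℝ (Fin d)) => x i) M.law :=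
  iIndepFun_pi (X := fun _ => id) fun _ => aemeasurable_id

lemma hasLaw_sub {i j : Fin n} (hij : i ≠ j) :
    HasLaw (fun x : Fin n → EuclideanSpace ℝ (Fin d) => x i - x j)
      (multivariateGaussian (M.mean (M.label i) - M.mean (M.label j))
        (M.cov (M.label i) + M.cov (M.label j))) M.law :=
  map_sub_multivariateGaussian (M.cov_posSemidef _) (M.cov_posSemidef _) (M.hasLaw_eval i)
    (M.hasLaw_eval j) (M.iIndepFun_eval.indepFun hij)

/-- The largest eigenvalue of the covariance matrix of the observation `i`. -/
def rho (i : Fin n) : ℝ := largestEigenvalue (M.cov (M.label i))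

lemma rho_nonneg (i : Fin n) : 0 ≤ M.rho i := largestEigenvalue_nonneg (M.cov_posSemidef _)

end Model

/-- Concentration of the entries of the affinity matrix. -/
lemma exists_entry_concentration : ∃ D : ℝ, 0 ≤ D ∧
    ∀ (n d K : ℕ) (M : Model n d K) (f : ℝ≥0 → ℝ) (l : ℝ≥0),
      (∀ h, f h ∈ Set.Icc (0 : ℝ) 1) → LipschitzWith l f → ∀ i j : Fin n,
      ∫ x, |affinity f x i j - M.meanAffinity f i j| ∂M.law
        ≤ 2 * l * Real.sqrt (M.rho i + M.rho j) ∧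
      ∫ x, (affinity f x i j - M.meanAffinity f i j) ^ 4 ∂M.law
        ≤ (D * l ^ 2 * (M.rho i + M.rho j)) ^ 2 := by
  obtain ⟨D, hD, h⟩ := exists_affinity_concentration
  refine ⟨D, hD, fun n d K M f l hf hlip i j => ?_⟩
  have hi := M.rho_nonneg i
  have hj := M.rho_nonneg j
  rcases eq_or_ne i j with rfl | hij
  · have : ∀ x : Fin n → EuclideanSpace ℝ (Fin d),
        affinity f x i i - M.meanAffinity f i i = 0 := fun x => by
      simp [Model.meanAffinity, affinity]
    simp only [this]
    constructor <;> simp <;> positivity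
  · have hlaw := M.hasLaw_sub hij
    set S := M.cov (M.label i) + M.cov (M.label j) with hS
    set m := M.mean (M.label i) - M.mean (M.label j) with hm
    have hpsd : S.PosSemidef := (M.cov_posSemidef _).add (M.cov_posSemidef _)
    obtain ⟨h1, h4⟩ := h d m S hpsd f l hf hlip
    have hρ : largestEigenvalue S ≤ M.rho i + M.rho j :=
      largestEigenvalue_add_le (M.cov_posSemidef _) (M.cov_posSemidef _)
    have hρ0 := largestEigenvalue_nonneg hpsd
    have hcont := continuous_affinity_entry (d := d) hlip
    have hmean : M.meanAffinity f i j = ∫ w, f ‖w‖₊ ∂multivariateGaussian m S :=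
      hlaw.integral_comp (f := fun w => f ‖w‖₊) hcont.aestronglyMeasurable
    rw [hmean]
    set a := ∫ w, f ‖w‖₊ ∂multivariateGaussian m S with ha
    have e1 := hlaw.integral_comp (f := fun w => |f ‖w‖₊ - a|)
      (hcont.sub continuous_const).abs.aestronglyMeasurable
    have e4 := hlaw.integral_comp (f := fun w => (f ‖w‖₊ - a) ^ 4)
      ((hcont.sub continuous_const).pow 4).aestronglyMeasurable
    constructor
    · refine (e1.trans_le h1).trans ?_
      gcongr
    · refine (e4.trans_le h4).trans ?_
      gcongr

/-! ### Sums over pairs of independent observations -/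

section Pairs

variable {n : ℕ} [NeZero n]

/-- Sorting by `k = i + j` in `ℤ/n`: within one class the unordered pairs `{i, k - i}` are disjoint,
so their contributions are independent. -/
lemma sum_sum_eq_sum_antidiagonals (W : Fin n → Fin n → ℝ) :
    ∑ i, ∑ j, W i j = ∑ k, ∑ i, W i (k - i) := by
  rw [Finset.sum_comm (f := fun k i => W i (k - i))]
  exact Finset.sum_congr rfl fun i _ => ((Equiv.subRight i).sum_comp (fun j => W i j)).symm

/-- The involution `i ↦ k - i` exchanges the two strict halves, and its fixed points lie on the
diagonal, where `W` vanishes. -/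
lemma sum_antidiagonal_eq_two_mul {W : Fin n → Fin n → ℝ} (hsymm : ∀ i j, W i j = W j i)
    (hdiag : ∀ i, W i i = 0) (k : Fin n) :
    ∑ i, W i (k - i) = 2 * ∑ i : {i : Fin n // i < k - i}, W i (k - i) := by
  have hsplit : ∀ i, W i (k - i) = (if i < k - i then W i (k - i) else 0)
      + (if k - i < i then W i (k - i) else 0) := by
    intro i
    rcases lt_trichotomy i (k - i) with h | h | h
    · simp [h, h.not_gt]
    · rw [← h]; simp [hdiag]
    · simp [h, h.not_gt]
  have hre : ∑ i, (if k - i < i then W i (k - i) else 0)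
      = ∑ i, (if i < k - i then W i (k - i) else 0) := by
    rw [← (Equiv.subLeft k).sum_comp (fun i => if k - i < i then W i (k - i) else 0)]
    refine Finset.sum_congr rfl fun i _ => ?_
    simp only [Equiv.subLeft_apply, sub_sub_cancel]
    rw [hsymm (k - i) i]
  have hsub : ∑ i : {i : Fin n // i < k - i}, W i (k - i)
      = ∑ i, (if i < k - i then W i (k - i) else 0) := by
    rw [← Finset.sum_filter, ← Finset.sum_subtype_eq_sum_filter]
    simp
  rw [Finset.sum_congr rfl fun i _ => hsplit i, Finset.sum_add_distrib, hre, hsub]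
  ring

/-- The condition `i < k - i` selects one index of each pair, so different selected indices give
pairs without a common observation. -/
lemma indepFun_antidiagonal {Ω E : Type*} [MeasurableSpace Ω] [MeasurableSpace E] {P : Measure Ω}
    {x : Fin n → Ω → E} (hx : iIndepFun x P) (hxm : ∀ i, Measurable (x i))
    {g : Fin n → Fin n → E × E → ℝ} (hg : ∀ i j, Measurable (g i j)) (k : Fin n)
    (s : Finset {i : Fin n // i < k - i}) (i : {i : Fin n // i < k - i}) (hi : i ∉ s) :
    IndepFun (fun ω => ∑ j ∈ s, g j (k - j) (x j ω, x (k - j) ω))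
      (fun ω => g i (k - i) (x i ω, x (k - i) ω)) P := by
  classical
  set A : Finset (Fin n) := s.biUnion fun j => {j.1, k - j.1} with hA
  set B : Finset (Fin n) := {i.1, k - i.1} with hB
  have hdisj : Disjoint A B := by
    rw [Finset.disjoint_left]
    intro a ha hb
    simp only [hA, hB, Finset.mem_biUnion, Finset.mem_insert, Finset.mem_singleton] at ha hb
    obtain ⟨j, hj, hja⟩ := ha
    have hne : j.1 ≠ i.1 := fun h => hi (Subtype.ext h ▸ hj)
    have hj2 := j.2
    have hi2 := i.2
    rcases hja with rfl | rfl <;> rcases hb with h | h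
    · exact hne h
    · rw [h, sub_sub_cancel] at hj2; exact lt_asymm hi2 hj2
    · rw [h] at hj2; rw [← h, sub_sub_cancel] at hi2; rw [← h] at hj2; exact lt_asymm hi2 hj2
    · exact hne (sub_right_injective h)
  have hmemA : ∀ j : s, j.1.1 ∈ A ∧ k - j.1.1 ∈ A := fun j => by
    constructor <;> exact Finset.mem_biUnion.2 ⟨j.1, j.2, by simp⟩
  have hmemB : i.1 ∈ B ∧ k - i.1 ∈ B := by simp [hB]
  have h := hx.indepFun_finset A B hdisj hxm
  have h' := h.comp
    (φ := fun u => ∑ j : s, g j.1 (k - j.1) (u ⟨j.1.1, (hmemA j).1⟩, u ⟨k - j.1.1, (hmemA j).2⟩))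
    (ψ := fun u => g i (k - i) (u ⟨i.1, hmemB.1⟩, u ⟨k - i.1, hmemB.2⟩))
    (Finset.measurable_sum _ fun j _ => (hg _ _).comp (by fun_prop))
    ((hg _ _).comp (by fun_prop))
  have e : (fun ω => ∑ j ∈ s, g j (k - j) (x j ω, x (k - j) ω))
      = fun ω => ∑ j : s, g j.1 (k - j.1) (x j.1 ω, x (k - j.1) ω) := by
    ext ω
    rw [← Finset.sum_coe_sort s]
  rw [e]
  exact h'

end Pairs

/-- The fourth moment of a centered sum over all pairs of independent observations. -/
theorem integral_sum_pairs_pow_four_le {n : ℕ} {Ω E : Type*} [MeasurableSpace Ω]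
    [MeasurableSpace E] {P : Measure Ω} [IsProbabilityMeasure P]
    {x : Fin n → Ω → E} (hx : iIndepFun x P) (hxm : ∀ i, Measurable (x i))
    {g : Fin n → Fin n → E × E → ℝ} (hg : ∀ i j, Measurable (g i j))
    (hsymm : ∀ i j ω, g i j (x i ω, x j ω) = g j i (x j ω, x i ω))
    (hdiag : ∀ i ω, g i i (x i ω, x i ω) = 0)
    (hL : ∀ i j, MemLp (fun ω => g i j (x i ω, x j ω)) 4 P)
    (hmean : ∀ i j, ∫ ω, g i j (x i ω, x j ω) ∂P = 0)
    {r : Fin n → ℝ} (hr : ∀ i, 0 ≤ r i)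
    (h4 : ∀ i j, ∫ ω, g i j (x i ω, x j ω) ^ 4 ∂P ≤ (r i + r j) ^ 2) :
    ∫ ω, (∑ i, ∑ j, g i j (x i ω, x j ω)) ^ 4 ∂P ≤ 192 * n ^ 4 * (∑ i, r i) ^ 2 := by
  rcases Nat.eq_zero_or_pos n with rfl | hn
  · simp
  have : NeZero n := ⟨hn.ne'⟩
  set S : Fin n → Ω → ℝ :=
    fun k ω => ∑ i : {i : Fin n // i < k - i}, g i (k - i) (x i ω, x (k - i) ω) with hS
  have hsum : ∀ ω, ∑ i, ∑ j, g i j (x i ω, x j ω) = 2 * ∑ k, S k ω := by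
    intro ω
    rw [sum_sum_eq_sum_antidiagonals (fun i j => g i j (x i ω, x j ω)), Finset.mul_sum]
    exact Finset.sum_congr rfl fun k _ => sum_antidiagonal_eq_two_mul
      (W := fun i j => g i j (x i ω, x j ω)) (fun i j => hsymm i j ω) (fun i => hdiag i ω) k
  have hR : 0 ≤ ∑ i, r i := Finset.sum_nonneg fun i _ => hr i
  -- `12 = 3 * 2 ^ 2`, the weights `r i + r (k - i)` summing to at most `2 * ∑ i, r i`.
  have hk : ∀ k, MemLp (S k) 4 P ∧ ∫ ω, S k ω ^ 4 ∂P ≤ 12 * (∑ i, r i) ^ 2 := by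
    intro k
    obtain ⟨h1, -, h2⟩ := integral_sum_pow_of_indep (P := P)
      (X := fun (i : {i : Fin n // i < k - i}) ω => g i (k - i) (x i ω, x (k - i) ω))
      (a := fun i => r i + r (k - i))
      (fun s i hi => indepFun_antidiagonal hx hxm hg k s i hi)
      (fun i => hL _ _) (fun i => hmean _ _) (fun i => add_nonneg (hr _) (hr _))
      (fun i => h4 _ _) Finset.univ
    refine ⟨h1, h2.trans ?_⟩
    have hle : ∑ i : {i : Fin n // i < k - i}, (r i + r (k - i)) ≤ 2 * ∑ i, r i := by
      calc ∑ i : {i : Fin n // i < k - i}, (r i + r (k - i))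
          = ∑ i ∈ Finset.univ.filter (fun i : Fin n => i < k - i), (r i + r (k - i)) := by
            rw [← Finset.sum_subtype_eq_sum_filter]; simp
        _ ≤ ∑ i, (r i + r (k - i)) :=
            Finset.sum_le_sum_of_subset_of_nonneg (Finset.filter_subset _ _)
              fun i _ _ => add_nonneg (hr _) (hr _)
        _ = 2 * ∑ i, r i := by
            have h3 : ∑ i, r (k - i) = ∑ i, r i := (Equiv.subLeft k).sum_comp r
            rw [Finset.sum_add_distrib, h3]; ring
    have h0 : 0 ≤ ∑ i : {i : Fin n // i < k - i}, (r i + r (k - i)) :=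
      Finset.sum_nonneg fun i _ => add_nonneg (hr _) (hr _)
    have := pow_le_pow_left₀ h0 hle 2
    nlinarith
  -- The antidiagonal sums depend on each other, so they are combined by Cauchy–Schwarz, applied
  -- twice.
  have hpow : ∀ ω, (∑ i, ∑ j, g i j (x i ω, x j ω)) ^ 4 ≤ 16 * n ^ 3 * ∑ k, S k ω ^ 4 := by
    intro ω
    rw [hsum ω, mul_pow]
    have h1 := sq_sum_le_card_mul_sum_sq (s := Finset.univ) (f := fun k => S k ω)
    have h2 := sq_sum_le_card_mul_sum_sq (s := Finset.univ) (f := fun k => S k ω ^ 2)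
    simp only [Finset.card_univ, Fintype.card_fin, ← pow_mul] at h1 h2
    calc 2 ^ 4 * (∑ k, S k ω) ^ 4 = 16 * ((∑ k, S k ω) ^ 2) ^ 2 := by ring
      _ ≤ 16 * (n * ∑ k, S k ω ^ 2) ^ 2 := by gcongr
      _ = 16 * n ^ 2 * (∑ k, S k ω ^ 2) ^ 2 := by ring
      _ ≤ 16 * n ^ 2 * (n * ∑ k, S k ω ^ 4) := by gcongr
      _ = _ := by ring
  have hint : Integrable (fun ω => 16 * (n : ℝ) ^ 3 * ∑ k, S k ω ^ 4) P :=
    (integrable_finsetSum _ fun k _ => integrable_pow_of_memLp_four (hk k).1 le_rfl).const_mul _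
  have hLsum : MemLp (fun ω => ∑ i, ∑ j, g i j (x i ω, x j ω)) 4 P :=
    memLp_finsetSum _ fun i _ => memLp_finsetSum _ fun j _ => hL i j
  calc ∫ ω, (∑ i, ∑ j, g i j (x i ω, x j ω)) ^ 4 ∂P
      ≤ ∫ ω, 16 * (n : ℝ) ^ 3 * ∑ k, S k ω ^ 4 ∂P :=
        integral_mono (integrable_pow_of_memLp_four hLsum le_rfl) hint hpow
    _ = 16 * n ^ 3 * ∑ k, ∫ ω, S k ω ^ 4 ∂P := by
        rw [integral_const_mul,
          integral_finsetSum _ fun k _ => integrable_pow_of_memLp_four (hk k).1 le_rfl]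
    _ ≤ 16 * n ^ 3 * ∑ _k : Fin n, 12 * (∑ i, r i) ^ 2 := by
        gcongr with k
        exact (hk k).2
    _ = 192 * n ^ 4 * (∑ i, r i) ^ 2 := by
        simp; ring

/-! ### Concentration of the affinity matrix -/

namespace Model

variable {n d K : ℕ} (M : Model n d K)

lemma affinity_comm {n d : ℕ} (f : ℝ≥0 → ℝ) (x : Fin n → EuclideanSpace ℝ (Fin d))
    (i j : Fin n) : affinity f x i j = affinity f x j i := by
  simp only [affinity, ← nndist_eq_nnnorm, nndist_comm]

lemma meanAffinity_comm (f : ℝ≥0 → ℝ) (i j : Fin n) :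
    M.meanAffinity f i j = M.meanAffinity f j i := by
  simp only [meanAffinity, affinity_comm f _ i j]

lemma meanAffinity_mem_Icc {f : ℝ≥0 → ℝ} {l : ℝ≥0} (hf : ∀ h, f h ∈ Set.Icc (0 : ℝ) 1)
    (hlip : LipschitzWith l f) (i j : Fin n) : M.meanAffinity f i j ∈ Set.Icc (0 : ℝ) 1 := by
  refine ⟨integral_nonneg fun x => (hf _).1, ?_⟩
  have hi : Integrable (fun x => affinity f x i j) M.law :=
    Integrable.of_bound (continuous_affinity hlip i j).aestronglyMeasurable 1
      (ae_of_all _ fun x => by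
        rw [Real.norm_eq_abs, abs_le]
        have := hf ‖x i - x j‖₊
        constructor <;> simp only [affinity] <;> linarith [this.1, this.2])
  calc M.meanAffinity f i j ≤ ∫ _, (1 : ℝ) ∂M.law :=
        integral_mono hi (integrable_const 1) fun x => (hf _).2
    _ = 1 := by simp

lemma p_le {f : ℝ≥0 → ℝ} {l : ℝ≥0} (hf : ∀ h, f h ∈ Set.Icc (0 : ℝ) 1)
    (hlip : LipschitzWith l f) {i j : Fin n} (hij : M.label i = M.label j) :
    M.p f ≤ M.meanAffinity f i j := by
  refine csInf_le ⟨0, ?_⟩ ⟨i, j, hij, rfl⟩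
  rintro _ ⟨i, j, -, rfl⟩
  exact (M.meanAffinity_mem_Icc hf hlip i j).1

lemma le_q {f : ℝ≥0 → ℝ} {l : ℝ≥0} (hf : ∀ h, f h ∈ Set.Icc (0 : ℝ) 1)
    (hlip : LipschitzWith l f) {i j : Fin n} (hij : M.label i ≠ M.label j) :
    M.meanAffinity f i j ≤ M.q f := by
  refine le_csSup ⟨1, ?_⟩ ⟨i, j, hij, rfl⟩
  rintro _ ⟨i, j, -, rfl⟩
  exact (M.meanAffinity_mem_Icc hf hlip i j).2

lemma sum_rho : ∑ i, M.rho i = n * M.sigma ^ 2 := by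
  rcases Nat.eq_zero_or_pos n with rfl | hn
  · simp
  · exact M.sum_largestEigenvalue hn

/-- Cauchy–Schwarz over the `n ^ 2` pairs gives the factor `√2`, rounded up to `3 / 2`. -/
lemma sum_sqrt_rho_le : ∑ i, ∑ j, Real.sqrt (M.rho i + M.rho j) ≤ 3 / 2 * n ^ 2 * M.sigma := by
  have hσ := M.sigma_nonneg
  refine (abs_le_of_sq_le_sq' ?_ (by positivity)).2
  rw [← Fintype.sum_prod_type' (fun i j => Real.sqrt (M.rho i + M.rho j))]
  have h := sq_sum_le_card_mul_sum_sq (s := Finset.univ)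
    (f := fun p : Fin n × Fin n => Real.sqrt (M.rho p.1 + M.rho p.2))
  refine h.trans ?_
  have e : ∑ p : Fin n × Fin n, Real.sqrt (M.rho p.1 + M.rho p.2) ^ 2 = 2 * n ^ 2 * M.sigma ^ 2 := by
    rw [Finset.sum_congr rfl fun p _ =>
      Real.sq_sqrt (add_nonneg (M.rho_nonneg p.1) (M.rho_nonneg p.2)),
      Fintype.sum_prod_type' (fun i j => M.rho i + M.rho j)]
    simp only [Finset.sum_add_distrib, Finset.sum_const, Finset.card_univ, Fintype.card_fin,
      nsmul_eq_mul, ← Finset.mul_sum, M.sum_rho]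
    ring
  rw [e]
  simp only [Finset.card_univ, Fintype.card_prod, Fintype.card_fin, Nat.cast_mul]
  have : 0 ≤ (n : ℝ) ^ 4 * M.sigma ^ 2 := by positivity
  nlinarith

end Model

/-- With high probability the affinity matrix is close to its expectation. -/
theorem exists_affinity_tail : ∃ C : ℝ, ∀ (n d K : ℕ) (M : Model n d K) (f : ℝ≥0 → ℝ) (l : ℝ≥0),
    (∀ h, f h ∈ Set.Icc (0 : ℝ) 1) → LipschitzWith l f →
    M.law.real {x | 4 * n ^ 2 * (M.sigma * l) < norm1 (affinity f x - M.meanAffinity f)}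
      ≤ C / n ^ 2 := by
  obtain ⟨D, hD, hconc⟩ := exists_entry_concentration
  refine ⟨3072 * D ^ 2, fun n d K M f l hf hlip => ?_⟩
  rcases Nat.eq_zero_or_pos n with rfl | hn
  · simp [norm1]
  have hn' : (0 : ℝ) < n := by exact_mod_cast hn
  have hσ := M.sigma_nonneg
  set Abar := M.meanAffinity f with hAbar
  set μ : Fin n → Fin n → ℝ := fun i j => ∫ x, |affinity f x i j - Abar i j| ∂M.law with hμ
  set g : Fin n → Fin n → EuclideanSpace ℝ (Fin d) × EuclideanSpace ℝ (Fin d) → ℝ :=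
    fun i j p => |f ‖p.1 - p.2‖₊ - Abar i j| - μ i j with hg
  have hgx : ∀ i j (x : Fin n → EuclideanSpace ℝ (Fin d)),
      g i j (x i, x j) = |affinity f x i j - Abar i j| - μ i j :=
    fun i j x => rfl
  have hbound : ∀ i j,
      MemLp (fun x : Fin n → EuclideanSpace ℝ (Fin d) => |affinity f x i j - Abar i j|) 4 M.law := by
    intro i j
    refine MemLp.of_bound ((continuous_affinity hlip i j).sub
      continuous_const).abs.aestronglyMeasurable 1 (ae_of_all _ fun x => ?_)
    have h1 := hf ‖x i - x j‖₊
    have h2 := M.meanAffinity_mem_Icc hf hlip i j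
    rw [Real.norm_eq_abs, abs_abs, abs_le]
    simp only [affinity]
    constructor <;> linarith [h1.1, h1.2, h2.1, h2.2]
  have hmoment := integral_sum_pairs_pow_four_le (P := M.law)
    (x := fun i (x : Fin n → EuclideanSpace ℝ (Fin d)) => x i) M.iIndepFun_eval
    (fun i => measurable_pi_apply i)
    (g := g)
    (fun i j => by
      have : Continuous fun p : EuclideanSpace ℝ (Fin d) × EuclideanSpace ℝ (Fin d) =>
          |f ‖p.1 - p.2‖₊ - Abar i j| - μ i j := by
        have := (continuous_affinity_entry (d := d) hlip).comp
          (by fun_prop : Continuous fun p : EuclideanSpace ℝ (Fin d) × EuclideanSpace ℝ (Fin d) =>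
            p.1 - p.2)
        exact ((this.sub continuous_const).abs.sub continuous_const)
      exact this.measurable)
    (fun i j x => by
      simp only [hgx, hμ, Model.affinity_comm f _ i j, hAbar, M.meanAffinity_comm f i j])
    (fun i x => by
      have h0 : Abar i i = f 0 := by simp [hAbar, Model.meanAffinity, affinity]
      simp only [hgx, hμ, h0]
      simp [affinity])
    (fun i j => (hbound i j).sub (memLp_const _))
    (fun i j => by
      simp only [hgx]
      rw [integral_sub ((hbound i j).integrable (by norm_num)) (integrable_const _)]
      simp only [integral_const, probReal_univ, one_smul]
      exact sub_self _)
    -- The 4 is the square root of the factor 16 for centering the absolute deviations at their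
    -- means `μ i j`.
    (r := fun i => 4 * D * l ^ 2 * M.rho i)
    (fun i => mul_nonneg (by positivity) (M.rho_nonneg i))
    (fun i j => by
      have h1 := integral_sub_integral_pow_four_le (hbound i j) 0
      have h2 := (hconc n d K M f l hf hlip i j).2
      simp only [sub_zero, (by decide : Even 4).pow_abs] at h1
      simp only [hgx]
      calc _ ≤ 16 * ∫ x, (affinity f x i j - Abar i j) ^ 4 ∂M.law := h1
        _ ≤ 16 * (D * l ^ 2 * (M.rho i + M.rho j)) ^ 2 := by linarith
        _ = _ := by ring)
  simp only [hgx] at hmoment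
  rw [← Finset.mul_sum, M.sum_rho] at hmoment
  set T : (Fin n → EuclideanSpace ℝ (Fin d)) → ℝ :=
    fun x => ∑ i, ∑ j, (|affinity f x i j - Abar i j| - μ i j) with hT
  have hTL : MemLp T 4 M.law := memLp_finsetSum _ fun i _ => memLp_finsetSum _ fun j _ =>
    (hbound i j).sub (memLp_const _)
  have hTi := integrable_pow_of_memLp_four hTL le_rfl
  have hμsum : ∑ i, ∑ j, μ i j ≤ 3 * (n ^ 2 * (M.sigma * l)) := by
    calc ∑ i, ∑ j, μ i j ≤ ∑ i, ∑ j, 2 * l * Real.sqrt (M.rho i + M.rho j) :=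
          Finset.sum_le_sum fun i _ => Finset.sum_le_sum fun j _ =>
            (hconc n d K M f l hf hlip i j).1
      _ = 2 * l * ∑ i, ∑ j, Real.sqrt (M.rho i + M.rho j) := by simp only [Finset.mul_sum]
      _ ≤ 2 * l * (3 / 2 * n ^ 2 * M.sigma) := by gcongr; exact M.sum_sqrt_rho_le
      _ = _ := by ring
  have hnorm : ∀ x : Fin n → EuclideanSpace ℝ (Fin d),
      norm1 (affinity f x - Abar) = T x + ∑ i, ∑ j, μ i j := by
    intro x
    simp only [hT, norm1, ← Finset.sum_add_distrib, sub_add_cancel, Matrix.sub_apply]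
  set t : ℝ := n ^ 2 * (M.sigma * l) with ht
  have ht0 : 0 ≤ t := by positivity
  -- Of the 4 units of `t`, the mean of the norm uses at most 3, which leaves 1 for the fluctuation
  -- `T`.
  have hsub : {x | 4 * (n : ℝ) ^ 2 * (M.sigma * l) < norm1 (affinity f x - Abar)}
      ⊆ {x | t < T x} := by
    intro x hx
    simp only [Set.mem_ofPred_eq, hnorm, mul_assoc, ← ht] at hx ⊢
    linarith
  refine (measureReal_mono hsub).trans ?_
  -- The moment is of order `n ^ 6` against `n ^ 8` in `t ^ 4`, a summable ratio. `3072 = 192 * 4 ^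
  -- 2`.
  have hm2 : ∫ x, T x ^ 4 ∂M.law ≤ 3072 * D ^ 2 / n ^ 2 * t ^ 4 := by
    refine hmoment.trans (le_of_eq ?_)
    rw [ht]; field_simp; ring
  -- Markov's inequality needs `t > 0`; if `σ ℓ = 0`, then `T` vanishes almost surely.
  rcases ht0.eq_or_lt with h0 | hpos
  · have h4 : ∫ x, T x ^ 4 ∂M.law = 0 := by
      refine le_antisymm ?_ (integral_nonneg fun x => by positivity)
      simpa [← h0] using hm2
    have hae := (integral_eq_zero_iff_of_nonneg (fun x => by positivity) hTi).1 h4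
    have hz : M.law {x | t < T x} = 0 := by
      refine measure_eq_zero_iff_ae_notMem.2 ?_
      filter_upwards [hae] with x hx
      have : T x = 0 := pow_eq_zero_iff (n := 4) (by norm_num) |>.1 hx
      simp [this, ← h0]
    rw [Measure.real, hz]
    simp only [ENNReal.toReal_zero]
    positivity
  · have hmarkov := mul_meas_ge_le_integral_of_nonneg (μ := M.law)
      (ae_of_all _ fun x => by positivity : 0 ≤ᵐ[M.law] fun x => T x ^ 4) hTi (t ^ 4)
    have hsub2 : {x | t < T x} ⊆ {x | t ^ 4 ≤ T x ^ 4} := fun x hx =>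
      pow_le_pow_left₀ ht0 (le_of_lt hx) 4
    have hle := measureReal_mono hsub2 (μ := M.law)
    refine hle.trans (le_of_mul_le_mul_left ?_ (by positivity : 0 < t ^ 4))
    rw [mul_comm (t ^ 4) (_ / _)]
    exact hmarkov.trans hm2

/-! ### Almost sure recovery -/

lemma le_sqrt_two_mul_log_two : 11 / 10 ≤ Real.sqrt (2 * Real.log 2) := by
  refine Real.le_sqrt_of_sq_le ?_
  have := Real.log_two_gt_d9
  norm_num; linarith

/-- The bounds on the estimation error and on the error rate, on the event that the affinity
matrix is close to its expectation. -/
lemma recovery_of_norm1_le {n d K : ℕ} (M : Model n d K) {f : ℝ≥0 → ℝ} {l : ℝ≥0}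
    (hf : ∀ h, f h ∈ Set.Icc (0 : ℝ) 1) (hlip : LipschitzWith l f) (hpq : M.q f < M.p f)
    {A Z : Matrix (Fin n) (Fin n) ℝ} (hZ : IsSDPSolution A M.lam0 Z) (hn : 11 ≤ n)
    (hA : norm1 (A - M.meanAffinity f) ≤ 4 * n ^ 2 * (M.sigma * l)) :
    norm1 (Z - M.clusterMatrix) / (n : ℝ) ^ 2 ≤ M.t0 f l ∧ M.errorRate Z ≤ 2 * M.t0 f l := by
  have hn' : (11 : ℝ) ≤ n := by exact_mod_cast hn
  have hδ : 0 < M.p f - M.q f := sub_pos.2 hpq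
  have hσ := M.sigma_nonneg
  set y := M.sigma * l / (M.p f - M.q f) with hy
  have hy0 : 0 ≤ y := by positivity
  have hnorm : norm1 (Z - M.clusterMatrix) ≤ 8 * n ^ 2 * y := by
    have h := M.norm1_sub_clusterMatrix_le (fun i j h => M.p_le hf hlip h)
      (fun i j h => M.le_q hf hlip h) hZ
    rw [hy, ← mul_div_assoc, le_div_iff₀ hδ]
    linarith
  -- The spare factor `11/10` is what the error rate needs: `n / (n - 1) ≤ 11 / 10` for `n ≥ 11`.
  have ht0 : 8 * (11 / 10) * y ≤ M.t0 f l := by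
    have hK := one_le_grothendieckConst
    have e : M.t0 f l = 8 * (Real.sqrt (2 * Real.log 2) * grothendieckConst) * y := by
      rw [Model.t0, hy]; ring
    rw [e]
    gcongr
    nlinarith [le_sqrt_two_mul_log_two]
  constructor
  · rw [div_le_iff₀ (by positivity)]
    have : 0 ≤ (n : ℝ) ^ 2 * y := by positivity
    nlinarith [mul_le_mul_of_nonneg_left ht0 (by positivity : 0 ≤ (n : ℝ) ^ 2)]
  · refine (M.errorRate_le hZ.1.1 (by omega)).trans ?_
    have hpos : 0 < (n : ℝ) * ((n : ℝ) - 1) := mul_pos (by linarith) (by linarith)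
    calc 2 / ((n : ℝ) * ((n : ℝ) - 1)) * norm1 (Z - M.clusterMatrix)
        ≤ 2 / ((n : ℝ) * ((n : ℝ) - 1)) * (8 * n ^ 2 * y) := by gcongr
      _ ≤ 2 * (8 * (11 / 10) * y) := by
          rw [div_mul_eq_mul_div, div_le_iff₀ hpos]
          nlinarith [mul_nonneg (mul_nonneg hy0 (by linarith : (0 : ℝ) ≤ n))
            (by linarith : (0 : ℝ) ≤ n - 11)]
      _ ≤ 2 * M.t0 f l := by linarith

/-- Almost surely the affinity matrices of a sequence of models are eventually close to their
expectations. -/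
lemma ae_eventually_norm1_le {Ω : Type*} [MeasurableSpace Ω] (P : Measure Ω)
    [IsProbabilityMeasure P] (d K : ℕ → ℕ) (M : ∀ n, Model n (d n) (K n)) (f : ℕ → ℝ≥0 → ℝ)
    (l : ℕ → ℝ≥0) (hf : ∀ n h, f n h ∈ Set.Icc (0 : ℝ) 1) (hlip : ∀ n, LipschitzWith (l n) (f n))
    (x : ∀ n, Ω → Fin n → EuclideanSpace ℝ (Fin (d n))) (hx : ∀ n, HasLaw (x n) (M n).law P) :
    ∀ᵐ ω ∂P, ∀ᶠ n in atTop, norm1 (affinity (f n) (x n ω) - (M n).meanAffinity (f n))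
      ≤ 4 * n ^ 2 * ((M n).sigma * l n) := by
  obtain ⟨C, hC⟩ := exists_affinity_tail
  set B : ∀ n, Set (Fin n → EuclideanSpace ℝ (Fin (d n))) := fun n =>
    {y | 4 * n ^ 2 * ((M n).sigma * l n)
      < norm1 (affinity (f n) y - (M n).meanAffinity (f n))} with hB
  have hmeas : ∀ n, MeasurableSet (B n) := fun n => by
    refine measurableSet_lt measurable_const (Continuous.measurable ?_)
    exact continuous_finsetSum _ fun i _ => continuous_finsetSum _ fun j _ =>
      ((continuous_affinity (hlip n) i j).sub continuous_const).abs
  have hle : ∀ n, P {ω | x n ω ∈ B n} ≤ ENNReal.ofReal (C / n ^ 2) := fun n => by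
    have h := hC n (d n) (K n) (M n) (f n) (l n) (hf n) (hlip n)
    rw [(hx n).measure_eq (p := fun y => y ∈ B n) (hmeas n)]
    exact (ENNReal.le_ofReal_iff_toReal_le (measure_ne_top _ _)
      (measureReal_nonneg.trans h)).2 h
  have hsum : ∑' n, P {ω | x n ω ∈ B n} ≠ ⊤ := by
    refine ne_top_of_le_ne_top ?_ (ENNReal.tsum_le_tsum hle)
    have hs : Summable fun n : ℕ => C / (n : ℝ) ^ 2 := by
      simpa only [div_eq_mul_inv] using
        (Real.summable_nat_pow_inv.2 (by norm_num : 1 < 2)).mul_left C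
    exact hs.tsum_ofReal_ne_top
  filter_upwards [ae_eventually_notMem hsum] with ω hω
  filter_upwards [hω] with n hn
  exact not_lt.1 hn

/-! ### Small variances -/

/-- The mean distance of a Gaussian vector to its mean. -/
lemma integral_norm_sub_mean_le {d : ℕ} (m : EuclideanSpace ℝ (Fin d))
    {S : Matrix (Fin d) (Fin d) ℝ} (hS : S.PosSemidef) :
    Integrable (fun w => ‖w - m‖) (multivariateGaussian m S) ∧
    ∫ w, ‖w - m‖ ∂multivariateGaussian m S ≤ Real.sqrt (d * largestEigenvalue S) := by
  set ν := multivariateGaussian m S with hν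
  have hL2 : MemLp (fun w => w - m) 2 ν := (IsGaussian.memLp_two_fun_id).sub (memLp_const m)
  have hn2 : MemLp (fun w => ‖w - m‖) 2 ν := hL2.norm
  refine ⟨hn2.integrable (by norm_num), ?_⟩
  refine Real.le_sqrt_of_sq_le ?_
  have hvar := variance_nonneg (fun w => ‖w - m‖) ν
  rw [variance_eq_sub hn2] at hvar
  simp only [Pi.pow_apply] at hvar
  have hmean : ∀ k, ∫ w, w k ∂ν = m k := fun k => by
    have := (EuclideanSpace.proj k : EuclideanSpace ℝ (Fin d) →L[ℝ] ℝ).integral_comp_id_comm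
      (μ := ν) IsGaussian.integrable_id
    simp only [hν, integral_id_multivariateGaussian] at this
    exact this
  have hcoord : ∀ k, Integrable (fun w : EuclideanSpace ℝ (Fin d) => (w k - m k) ^ 2) ν ∧
      ∫ w, (w k - m k) ^ 2 ∂ν ≤ largestEigenvalue S := by
    intro k
    constructor
    · have h : MemLp (fun w : EuclideanSpace ℝ (Fin d) => w k - m k) 2 ν :=
        (hL2.continuousLinearMap_comp
          (EuclideanSpace.proj k : EuclideanSpace ℝ (Fin d) →L[ℝ] ℝ))
      exact h.integrable_sq
    · have h := variance_eval_multivariateGaussian (μ := m) hS k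
      rw [variance_eq_integral (by fun_prop), hmean k] at h
      rw [h]
      have h' := dotProduct_mulVec_le_largestEigenvalue hS.isHermitian
        (EuclideanSpace.single k (1 : ℝ))
      simpa using h'
  -- The crude trace bound depends on `d`, which is harmless where `d` is fixed.
  have hsq : ∫ w, ‖w - m‖ ^ 2 ∂ν ≤ d * largestEigenvalue S := by
    simp only [EuclideanSpace.real_norm_sq_eq, PiLp.sub_apply]
    rw [integral_finsetSum _ fun k _ => (hcoord k).1]
    calc _ ≤ ∑ _k : Fin d, largestEigenvalue S := Finset.sum_le_sum fun k _ => (hcoord k).2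
      _ = _ := by simp
  linarith

lemma Model.abs_meanAffinity_sub_le {n d K : ℕ} (M : Model n d K) {f : ℝ≥0 → ℝ} {l : ℝ≥0}
    (hf : ∀ h, f h ∈ Set.Icc (0 : ℝ) 1) (hlip : LipschitzWith l f) (i j : Fin n) :
    |M.meanAffinity f i j - f ‖M.mean (M.label i) - M.mean (M.label j)‖₊|
      ≤ l * Real.sqrt (d * (M.rho i + M.rho j)) := by
  rcases eq_or_ne i j with rfl | hij
  · simp only [Model.meanAffinity, affinity, sub_self, nnnorm_zero, integral_const,
      probReal_univ, one_smul, abs_zero]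
    positivity
  · have hlaw := M.hasLaw_sub hij
    set S := M.cov (M.label i) + M.cov (M.label j) with hS
    set m := M.mean (M.label i) - M.mean (M.label j) with hm
    have hpsd : S.PosSemidef := (M.cov_posSemidef _).add (M.cov_posSemidef _)
    have hρ : largestEigenvalue S ≤ M.rho i + M.rho j :=
      largestEigenvalue_add_le (M.cov_posSemidef _) (M.cov_posSemidef _)
    have hmean : M.meanAffinity f i j = ∫ w, f ‖w‖₊ ∂multivariateGaussian m S :=
      hlaw.integral_comp (f := fun w => f ‖w‖₊)
        (continuous_affinity_entry hlip).aestronglyMeasurable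
    obtain ⟨hint, hle⟩ := integral_norm_sub_mean_le m hpsd
    have hφ := (memLp_affinity_entry hlip hf (multivariateGaussian m S)).integrable (by norm_num)
    have e : M.meanAffinity f i j - f ‖m‖₊
        = ∫ w, (f ‖w‖₊ - f ‖m‖₊) ∂multivariateGaussian m S := by
      rw [hmean, integral_sub hφ (integrable_const _)]
      simp
    rw [e]
    calc |∫ w, (f ‖w‖₊ - f ‖m‖₊) ∂multivariateGaussian m S|
        ≤ ∫ w, |f ‖w‖₊ - f ‖m‖₊| ∂multivariateGaussian m S := abs_integral_le_integral_abs
      _ ≤ ∫ w, l * ‖w - m‖ ∂multivariateGaussian m S := by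
          refine integral_mono (hφ.sub (integrable_const _)).abs (hint.const_mul _) fun w => ?_
          have h := hlip.dist_le_mul ‖w‖₊ ‖m‖₊
          rw [Real.dist_eq, NNReal.dist_eq, coe_nnnorm, coe_nnnorm] at h
          exact h.trans (by gcongr; exact abs_norm_sub_norm_le w m)
      _ ≤ l * Real.sqrt (d * (M.rho i + M.rho j)) := by
          rw [integral_const_mul]
          gcongr
          exact hle.trans (by gcongr)

/-- A minimum over finitely many pairs of means. The bound `η ≤ f 0` serves the case without pairs
in distinct clusters, where `q = 0`. -/
lemma exists_separation {K d : ℕ} {mean : Fin K → EuclideanSpace ℝ (Fin d)} {f : ℝ≥0 → ℝ}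
    (hinj : Function.Injective mean) (hf : ∀ h, f h ∈ Set.Icc (0 : ℝ) 1)
    (hlt : ∀ h, 0 < h → f h < f 0) :
    ∃ η : ℝ, 0 < η ∧ η ≤ f 0 ∧ ∀ k k', k ≠ k' → f ‖mean k - mean k'‖₊ ≤ f 0 - η := by
  have hf0 : 0 < f 0 := (hf 1).1.trans_lt (hlt 1 one_pos)
  have hpos : ∀ q : {q : Fin K × Fin K // q.1 ≠ q.2},
      0 < f 0 - f ‖mean q.1.1 - mean q.1.2‖₊ := fun q =>
    sub_pos.2 (hlt _ (nnnorm_pos.2 (sub_ne_zero.2 fun h => q.2 (hinj h))))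
  rcases isEmpty_or_nonempty {q : Fin K × Fin K // q.1 ≠ q.2} with he | hne
  · exact ⟨f 0, hf0, le_rfl, fun k k' h => (he.false ⟨(k, k'), h⟩).elim⟩
  · obtain ⟨q, hq⟩ := Finite.exists_min fun q : {q : Fin K × Fin K // q.1 ≠ q.2} =>
      f 0 - f ‖mean q.1.1 - mean q.1.2‖₊
    refine ⟨min (f 0) (f 0 - f ‖mean q.1.1 - mean q.1.2‖₊), lt_min hf0 (hpos q),
      min_le_left _ _, fun k k' h => ?_⟩
    have h1 := hq ⟨(k, k'), h⟩
    have h2 := min_le_right (f 0) (f 0 - f ‖mean q.1.1 - mean q.1.2‖₊)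
    simp only at h1
    linarith

/-- For small variances the affinities within the clusters are separated from those between
different clusters. -/
lemma exists_gap {d K : ℕ} {mean : Fin K → EuclideanSpace ℝ (Fin d)} {f : ℝ≥0 → ℝ} {l : ℝ≥0}
    (hinj : Function.Injective mean) (hf : ∀ h, f h ∈ Set.Icc (0 : ℝ) 1)
    (hlip : LipschitzWith l f) (hlt : ∀ h, 0 < h → f h < f 0) :
    ∃ η : ℝ, 0 < η ∧ ∃ ε : ℝ, 0 < ε ∧ ∀ (n : ℕ) (M : Model n d K), 1 ≤ n → M.mean = mean →
      (∀ k, largestEigenvalue (M.cov k) ≤ ε) → η ≤ M.p f - M.q f := by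
  obtain ⟨η, hη, hη0, hsep⟩ := exists_separation hinj hf hlt
  -- `ε` is chosen so that `l * √(2 * d * ε) ≤ η / 4`; the added ones avoid division by zero. Two
  -- errors of `η / 4` leave a gap of `η / 2`.
  refine ⟨η / 2, by positivity, η ^ 2 / (32 * ((l : ℝ) + 1) ^ 2 * (d + 1)), by positivity, ?_⟩
  set ε := η ^ 2 / (32 * ((l : ℝ) + 1) ^ 2 * (d + 1)) with hε
  have hε0 : 0 < ε := by positivity
  have hεη : ε * (32 * ((l : ℝ) + 1) ^ 2 * (d + 1)) = η ^ 2 := by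
    rw [hε]; field_simp
  have hsmall : l * Real.sqrt (d * (ε + ε)) ≤ η / 4 := by
    refine (abs_le_of_sq_le_sq' ?_ (by positivity)).2
    rw [mul_pow, Real.sq_sqrt (by positivity)]
    have h1 : (l : ℝ) ^ 2 * d ≤ ((l : ℝ) + 1) ^ 2 * (d + 1) := by
      gcongr <;> linarith
    nlinarith [mul_le_mul_of_nonneg_left h1 hε0.le]
  intro n M hn hmean hcov
  have hentry : ∀ i j, |M.meanAffinity f i j
      - f ‖M.mean (M.label i) - M.mean (M.label j)‖₊| ≤ η / 4 := fun i j => by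
    refine (M.abs_meanAffinity_sub_le hf hlip i j).trans (le_trans ?_ hsmall)
    gcongr <;> exact hcov _
  have hp : f 0 - η / 4 ≤ M.p f := by
    refine le_csInf ⟨_, ⟨0, hn⟩, ⟨0, hn⟩, rfl, rfl⟩ ?_
    rintro _ ⟨i, j, hij, rfl⟩
    have h := hentry i j
    rw [hij, sub_self, nnnorm_zero] at h
    linarith [(abs_le.1 h).1]
  have hq : M.q f ≤ f 0 - 3 / 4 * η := by
    -- The side goal, nonnegativity of the bound, handles the supremum `0` of the empty set.
    refine Real.sSup_le ?_ (by linarith)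
    rintro _ ⟨i, j, hij, rfl⟩
    have h := hentry i j
    rw [hmean] at h
    have h' := hsep _ _ hij
    linarith [(abs_le.1 h).2]
  linarith

end GaussClust

end

/-! ### Assembly of the two claims. -/

theorem corollary1 :
    -- the almost sure asymptotic bounds
    (∀ {Ω : Type*} [MeasurableSpace Ω] (P : Measure Ω) [IsProbabilityMeasure P]
      (d K : ℕ → ℕ) (M : ∀ n, GaussClust.Model n (d n) (K n))
      (f : ℕ → ℝ≥0 → ℝ) (l : ℕ → ℝ≥0)
      (_hf : ∀ n h, f n h ∈ Set.Icc (0 : ℝ) 1) (_hlip : ∀ n, LipschitzWith (l n) (f n))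
      (_hpq : ∀ n, 1 ≤ n → (M n).q (f n) < (M n).p (f n))
      (x : ∀ n, Ω → Fin n → EuclideanSpace ℝ (Fin (d n)))
      (_hx : ∀ n, HasLaw (x n) (M n).law P)
      (Zhat : ∀ n, Ω → Matrix (Fin n) (Fin n) ℝ)
      (_hZ : ∀ n, ∀ᵐ ω ∂P,
        GaussClust.IsSDPSolution (GaussClust.affinity (f n) (x n ω)) (M n).lam0 (Zhat n ω)),
      ∀ᵐ ω ∂P,
        limsup (fun n : ℕ =>
            ((GaussClust.norm1 (Zhat n ω - (M n).clusterMatrix) / (n : ℝ) ^ 2 : ℝ) : EReal)) atTop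
          ≤ limsup (fun n : ℕ => (((M n).t0 (f n) (l n) : ℝ) : EReal)) atTop ∧
        limsup (fun n : ℕ => (((M n).errorRate (Zhat n ω) : ℝ) : EReal)) atTop
          ≤ limsup (fun n : ℕ => ((2 * (M n).t0 (f n) (l n) : ℝ) : EReal)) atTop) ∧
    -- the bound is of order `σ` for fixed, pairwise different means and small variances
    (∀ (d K : ℕ) (mean : Fin K → EuclideanSpace ℝ (Fin d)) (f : ℝ≥0 → ℝ) (l : ℝ≥0),
      Function.Injective mean → (∀ h, f h ∈ Set.Icc (0 : ℝ) 1) → LipschitzWith l f →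
      (∀ h, 0 < h → f h < f 0) →
      ∃ C : ℝ, ∃ ε : ℝ, 0 < ε ∧
        ∀ (n : ℕ) (M : GaussClust.Model n d K), 1 ≤ n → M.mean = mean →
          (∀ k, GaussClust.largestEigenvalue (M.cov k) ≤ ε) →
          M.q f < M.p f ∧ M.t0 f l ≤ C * M.sigma) := by
  constructor
  · intro Ω _ P _ d K M f l hf hlip hpq x hx Zhat hZ
    filter_upwards [GaussClust.ae_eventually_norm1_le P d K M f l hf hlip x hx,
      ae_all_iff.2 hZ] with ω hω hZω
    have key := hω.and (eventually_ge_atTop 11)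
    constructor
    -- In `EReal` the upper limits are monotone without boundedness conditions.
    · refine limsup_le_limsup ?_
      filter_upwards [key] with n hn
      exact EReal.coe_le_coe_iff.2 (GaussClust.recovery_of_norm1_le (M n) (hf n) (hlip n)
        (hpq n (by omega)) (hZω n) hn.2 hn.1).1
    · refine limsup_le_limsup ?_
      filter_upwards [key] with n hn
      exact EReal.coe_le_coe_iff.2 (GaussClust.recovery_of_norm1_le (M n) (hf n) (hlip n)
        (hpq n (by omega)) (hZω n) hn.2 hn.1).2
  · intro d K mean f l hinj hf hlip hlt
    obtain ⟨η, hη, ε, hε, h⟩ := GaussClust.exists_gap hinj hf hlip hlt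
    refine ⟨8 * Real.sqrt (2 * Real.log 2) * GaussClust.grothendieckConst * l / η, ε, hε,
      fun n M hn hmean hcov => ?_⟩
    have hgap := h n M hn hmean hcov
    refine ⟨by linarith, ?_⟩
    have hK : 0 ≤ GaussClust.grothendieckConst :=
      zero_le_one.trans GaussClust.one_le_grothendieckConst
    have hσ := M.sigma_nonneg
    calc M.t0 f l ≤ 8 * Real.sqrt (2 * Real.log 2) * GaussClust.grothendieckConst * M.sigma * l / η :=
          div_le_div_of_nonneg_left (by positivity) hη hgap
      _ = _ := by ring
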